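/- Let $s,N\in\mathbb N$, let $M\in\mathbb Z^{s\times s}$ be an integer matrix all of whose complex eigenvalues have modulus larger than $1$, and let $E$ be a complete set of representatives of $\mathbb Z^s/M\mathbb Z^s$. Let $\mathbf a^{(k)}:\mathbb Z^s\to\mathbb R$, $k\ge1$, be masks supported in $\{0,\dots,N\}^s$ and uniformly bounded, $\sup_{k,\alpha}|\mathbf a^{(k)}(\alpha)|<\infty$, with symbols $a^{(k)}_*(z)=\sum_{\alpha}\mathbf a^{(k)}(\alpha)z^\alpha$ and subdivision operators $(S_{\mathbf a^{(k)}}\mathbf c)(\alpha)=\sum_{\beta\in\mathbb Z^s}\mathbf a^{(k)}(\alpha-M\beta)\,c(\beta)$. Let $\Xi=\{e^{2\pi i M^{-T}\xi}:\xi\in\mathbb Z^s\}$ (exponential taken componentwise) and let $\mathcal A$ be the set of limits of convergent subsequences of $\{\mathbf a^{(k)}\}$. Put $G=\{0,\dots,N\}^s-E+\{-1,0,1\}^s$, $K=\mathbb Z^s\cap\sum_{r\ge1}M^{-r}G$, $T_{\varepsilon,\mathbf a}=[\mathbf a(\varepsilon+M\alpha-\beta)]_{\alpha,\beta\in K}$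 for $\varepsilon\in E$, and $V_0=\{v\in\mathbb R^{K}:\sum_{\alpha\in K}v_\alpha=0\}$. Assume that the symbols satisfy approximate sum rules of order $1$, i.e. $$\sum_{k\ge1}\mu_k<\infty,\quad \sum_{k\ge1}\delta_k<\infty,\qquad \mu_k=\bigl|a_*^{(k)}(1)-|\det M|\bigr|,\quad \delta_k=\max_{\epsilon\in\Xi\setminus\{1\}}|a_*^{(k)}(\epsilon)|,$$ and that the joint spectral radius of $\mathcal T_{\mathcal A}|_{V_0}=\{T_{\varepsilon,\mathbf a}|_{V_0}:\varepsilon\in E,\ \mathbf a\in\mathcal A\}$, $$\rho(\mathcal T_{\mathcal A}|_{V_0})=\lim_{n\to\infty}\ \sup_{T_1,\dots,T_n\in\mathcal T_{\mathcal A}|_{V_0}}\|T_1\cdots T_n\|^{1/n},$$ is less than $1$. Then the non-stationary scheme $\{S_{\mathbf a^{(k)}},k\ge1\}$ is $C^0$-convergent: for every bounded $\mathbf c:\mathbb Z^s\to\mathbb R$ there is a continuous $g_{\mathbf c}:\mathbb R^s\to\mathbb R$ such that for every test function $f$ $$\lim_{k\to\infty}\ \sup_{x\in\mathbb R^s}\Bigl|g_{\mathbf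 c}(x)-\sum_{\alpha\in\mathbb Z^s}\bigl(S_{\mathbf a^{(k)}}\cdots S_{\mathbf a^{(1)}}\mathbf c\bigr)(\alpha)\,f(M^kx-\alpha)\Bigr|=0 .$$ Here a test function is a continuous, compactly supported $f:\mathbb R^s\to\mathbb R$ with $\hat f(0)=1$ and $\hat f(\alpha)=0$ for $\alpha\in\mathbb Z^s\setminus\{0\}$ (where $\hat f(\omega)=\int f(x)e^{-2\pi i x\cdot\omega}\,dx$) that is stable: there are $0<C_1\le C_2<\infty$ with $C_1\|\mathbf c\|_{\ell_\infty}\le\|\sum_\alpha c(\alpha)f(\cdot-\alpha)\|_\infty\le C_2\|\mathbf c\|_{\ell_\infty}$ for all bounded $\mathbf c$. -/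

import Mathlib

open Filter Topology MeasureTheory
open scoped ENNReal Pointwise FourierTransform Matrix

/-- An integer matrix all of whose complex eigenvalues have modulus larger than one. -/
def IsExpanding {s : ℕ} (M : Matrix (Fin s) (Fin s) ℤ) : Prop :=
  ∀ z ∈ spectrum ℂ (M.map (Int.cast : ℤ → ℂ)), 1 < ‖z‖

/-- `M` as a real matrix. -/
def realMatrix {s : ℕ} (M : Matrix (Fin s) (Fin s) ℤ) : Matrix (Fin s) (Fin s) ℝ :=
  M.map (Int.cast : ℤ → ℝ)

/-- A point of `ℤ^s` as a point of `ℝ^s`. -/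
def toRealVec {s : ℕ} (α : Fin s → ℤ) : Fin s → ℝ := fun j => (α j : ℝ)

/-- `E` is a complete set of representatives of `ℤ^s / M ℤ^s`. -/
def IsCosetReps {s : ℕ} (M : Matrix (Fin s) (Fin s) ℤ) (E : Finset (Fin s → ℤ)) : Prop :=
  ∀ α : Fin s → ℤ, ∃! ε : Fin s → ℤ, ε ∈ E ∧ ∃ β : Fin s → ℤ, α = ε + M *ᵥ β

/-- The mask `b` is supported on `{0, …, N}^s`. -/
def SupportedOnBox {s : ℕ} (N : ℕ) (b : (Fin s → ℤ) → ℝ) : Prop :=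
  ∀ α : Fin s → ℤ, b α ≠ 0 → ∀ j, 0 ≤ α j ∧ α j ≤ (N : ℤ)

/-! ### Subdivision -/

/-- The subdivision operator `(S_b c)(α) = ∑_β b(α - Mβ) c(β)`. For a finitely supported mask and
an invertible `M` the sum is finite. -/
noncomputable def subdivision {s : ℕ} (M : Matrix (Fin s) (Fin s) ℤ) (b : (Fin s → ℤ) → ℝ)
    (c : (Fin s → ℤ) → ℝ) : (Fin s → ℤ) → ℝ :=
  fun α => ∑ᶠ β : Fin s → ℤ, b (α - M *ᵥ β) * c β

/-- The data after `k` steps of the scheme started at `c`. The mask used in the first step is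
`a 0`, so that `a k` is the mask of level `k + 1`. -/
noncomputable def subdivisionIter {s : ℕ} (M : Matrix (Fin s) (Fin s) ℤ)
    (a : ℕ → (Fin s → ℤ) → ℝ) (c : (Fin s → ℤ) → ℝ) : ℕ → (Fin s → ℤ) → ℝ
  | 0 => c
  | k + 1 => subdivision M (a k) (subdivisionIter M a c k)

/-- Bounded real sequences on `ℤ^s`. -/
def IsBoundedSeq {s : ℕ} (c : (Fin s → ℤ) → ℝ) : Prop := ∃ B : ℝ, ∀ α, |c α| ≤ B

/-! ### Test functions and `C⁰`-convergence -/

/-- The integer shifts of `f` are `ℓ_∞`-stable: the `L_∞`-norm of `∑_α c(α) f(· - α)` is equivalent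
to the `ℓ_∞`-norm of `c`. -/
def IsStable {s : ℕ} (f : (Fin s → ℝ) → ℝ) : Prop :=
  ∃ C₁ C₂ : ℝ, 0 < C₁ ∧ C₁ ≤ C₂ ∧ ∀ c : (Fin s → ℤ) → ℝ, IsBoundedSeq c →
    ENNReal.ofReal C₁ * (⨆ α, ‖c α‖ₑ) ≤
        eLpNorm (fun x => ∑ᶠ α : Fin s → ℤ, c α * f (x - toRealVec α)) ⊤ volume ∧
      eLpNorm (fun x => ∑ᶠ α : Fin s → ℤ, c α * f (x - toRealVec α)) ⊤ volume ≤
        ENNReal.ofReal C₂ * (⨆ α, ‖c α‖ₑ)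

/-- The Fourier transform `∫ f(x) exp(-2πi x·ω) dx` at an integer point `ω = α`. -/
noncomputable def fourierAt {s : ℕ} (f : (Fin s → ℝ) → ℝ) (α : Fin s → ℤ) : ℂ :=
  𝓕 (fun x : EuclideanSpace ℝ (Fin s) => ((f x.ofLp : ℝ) : ℂ)) (WithLp.toLp 2 (toRealVec α))

/-- Strang-Fix conditions of order one. -/
def StrangFixOne {s : ℕ} (f : (Fin s → ℝ) → ℝ) : Prop :=
  fourierAt f 0 = 1 ∧ ∀ α : Fin s → ℤ, α ≠ 0 → fourierAt f α = 0

/-- Test functions for `C⁰`-convergence. -/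
structure IsTestFunction {s : ℕ} (f : (Fin s → ℝ) → ℝ) : Prop where
  continuous : Continuous f
  hasCompactSupport : HasCompactSupport f
  stable : IsStable f
  strangFix : StrangFixOne f

/-- The scheme with dilation matrix `M` and masks `a` is `C⁰`-convergent: for all bounded initial
data `c` there is a continuous `g` such that, for every test function `f`,
`∑_α (S_{a_k} ⋯ S_{a_1} c)(α) f(M^k x - α)` converges to `g x` uniformly in `x`. -/
def IsC0Convergent {s : ℕ} (M : Matrix (Fin s) (Fin s) ℤ) (a : ℕ → (Fin s → ℤ) → ℝ) : Prop :=
  ∀ c : (Fin s → ℤ) → ℝ, IsBoundedSeq c →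
    ∃ g : (Fin s → ℝ) → ℝ, Continuous g ∧
      ∀ f : (Fin s → ℝ) → ℝ, IsTestFunction f →
        TendstoUniformly
          (fun (k : ℕ) (x : Fin s → ℝ) => ∑ᶠ α : Fin s → ℤ,
            subdivisionIter M a c k α * f ((realMatrix M) ^ k *ᵥ x - toRealVec α))
          g atTop

/-! ### Symbols and approximate sum rules of order one -/

/-- The symbol `∑_α b(α) z^α` of a finitely supported mask. -/
noncomputable def symbol {s : ℕ} (b : (Fin s → ℤ) → ℝ) (z : Fin s → ℂ) : ℂ :=
  ∑ᶠ α : Fin s → ℤ, (b α : ℂ) * ∏ j, z j ^ α j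

/-- The finite set `{exp(2πi M^{-T} ξ)}`, `ξ ∈ ℤ^s`; its elements depend on the class of `ξ` modulo
`M^T ℤ^s` only. -/
noncomputable def dualPoints {s : ℕ} (M : Matrix (Fin s) (Fin s) ℤ) : Set (Fin s → ℂ) :=
  {z | ∃ ξ : Fin s → ℤ, z = fun j =>
    Complex.exp (2 * Real.pi * Complex.I * (((realMatrix M)ᵀ⁻¹ *ᵥ toRealVec ξ) j : ℝ))}

/-- `|b_*(1) - |det M||`. -/
noncomputable def massDefect {s : ℕ} (M : Matrix (Fin s) (Fin s) ℤ) (b : (Fin s → ℤ) → ℝ) : ℝ :=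
  ‖symbol b 1 - ((|M.det| : ℤ) : ℂ)‖

/-- The sum rule defect: the maximum of `|b_*|` over the points of `dualPoints M` other than `1`. -/
noncomputable def sumRuleDefect {s : ℕ} (M : Matrix (Fin s) (Fin s) ℤ)
    (b : (Fin s → ℤ) → ℝ) : ℝ :=
  sSup ((fun z => ‖symbol b z‖) '' (dualPoints M \ {1}))

/-- Approximate sum rules of order one. -/
def ApproxSumRulesOne {s : ℕ} (M : Matrix (Fin s) (Fin s) ℤ) (a : ℕ → (Fin s → ℤ) → ℝ) : Prop :=
  Summable (fun k => massDefect M (a k)) ∧ Summable (fun k => sumRuleDefect M (a k))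

/-- The limits of the convergent subsequences of a sequence of masks. (For masks with a common
finite support pointwise convergence is convergence in norm.) -/
def limitPoints {s : ℕ} (a : ℕ → (Fin s → ℤ) → ℝ) : Set ((Fin s → ℤ) → ℝ) :=
  {b | ∃ φ : ℕ → ℕ, StrictMono φ ∧ Tendsto (fun n => a (φ n)) atTop (𝓝 b)}

/-! ### The index set of the transition matrices -/

/-- The integer points of `∑_{r ≥ 1} M^{-r} G`. -/
noncomputable def latticeAttractor {s : ℕ} (M : Matrix (Fin s) (Fin s) ℤ)
    (G : Finset (Fin s → ℤ)) : Set (Fin s → ℤ) :=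
  {α | ∃ g : ℕ → (Fin s → ℤ), (∀ r, g r ∈ G) ∧
    HasSum (fun r => ((realMatrix M)⁻¹) ^ (r + 1) *ᵥ toRealVec (g r)) (toRealVec α)}

section Finiteness

attribute [local instance] Matrix.linftyOpNormedRing Matrix.linftyOpNormedAlgebra

/-- The powers of the inverse of an expanding matrix are summable in norm. -/
theorem summable_norm_pow_inv {s : ℕ} {M : Matrix (Fin s) (Fin s) ℤ} (hM : IsExpanding M) :
    Summable (fun r : ℕ => ‖((realMatrix M)⁻¹) ^ (r + 1)‖) := by
  rcases Nat.eq_zero_or_pos s with rfl | hs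
  · have : ∀ r : ℕ, ((realMatrix M)⁻¹) ^ (r + 1) = 0 := fun r => Subsingleton.elim _ _
    simp only [this, norm_zero]
    exact summable_zero
  have : Nonempty (Fin s) := ⟨⟨0, hs⟩⟩
  have hmap : M.map (Int.cast : ℤ → ℂ) = Complex.ofRealHom.mapMatrix (realMatrix M) := by
    ext i j
    simp [realMatrix]
  have hunit : IsUnit (M.map (Int.cast : ℤ → ℂ)) := by
    by_contra h
    have h0 : (0 : ℂ) ∈ spectrum ℂ (M.map (Int.cast : ℤ → ℂ)) := spectrum.zero_mem_iff ℂ |>.2 h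
    have := hM 0 h0
    simp at this
    linarith
  have hdet : IsUnit (realMatrix M).det := by
    rw [Matrix.isUnit_iff_isUnit_det, hmap, ← RingHom.map_det] at hunit
    rw [isUnit_iff_ne_zero] at hunit ⊢
    intro h
    exact hunit (by simp [h])
  set B : Matrix (Fin s) (Fin s) ℂ := Complex.ofRealHom.mapMatrix ((realMatrix M)⁻¹) with hB
  let u : (Matrix (Fin s) (Fin s) ℂ)ˣ :=
    { val := M.map (Int.cast : ℤ → ℂ)
      inv := B
      val_inv := by
        rw [hmap, hB, ← map_mul, Matrix.mul_nonsing_inv _ hdet, map_one]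
      inv_val := by
        rw [hmap, hB, ← map_mul, Matrix.nonsing_inv_mul _ hdet, map_one] }
  have : CompleteSpace (Matrix (Fin s) (Fin s) ℂ) := FiniteDimensional.complete ℂ _
  have hrad : spectralRadius ℂ B < (1 : NNReal) := by
    refine spectrum.spectralRadius_lt_of_forall_lt B ?_
    intro z hz
    have hz' : z⁻¹ ∈ spectrum ℂ (u : Matrix (Fin s) (Fin s) ℂ) := spectrum.inv₀_mem_iff.2 hz
    have h1 := hM _ hz'
    rw [norm_inv] at h1
    have h2 : ‖z‖ < 1 := by
      by_contra hge
      exact absurd (inv_le_one_of_one_le₀ (not_lt.1 hge)) (not_le.2 h1)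
    exact_mod_cast h2
  obtain ⟨r, hr, hr1⟩ := ENNReal.lt_iff_exists_nnreal_btwn.1 hrad
  have hr1' : r < 1 := by exact_mod_cast hr1
  have hev : ∀ᶠ n : ℕ in atTop, ‖B ^ n‖ ≤ (r : ℝ) ^ n := by
    filter_upwards [(spectrum.pow_nnnorm_pow_one_div_tendsto_nhds_spectralRadius B).eventually_lt_const
      hr, eventually_gt_atTop 0] with n hn hn0
    have hn0' : (0 : ℝ) < n := by exact_mod_cast hn0
    have h1 := ENNReal.rpow_le_rpow hn.le hn0'.le
    rw [← ENNReal.rpow_mul, one_div, inv_mul_cancel₀ hn0'.ne', ENNReal.rpow_one,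
      ENNReal.rpow_natCast] at h1
    exact_mod_cast h1
  have hsumB : Summable (fun n : ℕ => ‖B ^ n‖) := by
    refine Summable.of_norm_bounded_eventually_nat (g := fun n => (r : ℝ) ^ n)
      (summable_geometric_of_lt_one r.2 (by exact_mod_cast hr1')) ?_
    filter_upwards [hev] with n hn
    simpa using hn
  have hnorm : ∀ n : ℕ, ‖((realMatrix M)⁻¹) ^ n‖ = ‖B ^ n‖ := by
    intro n
    rw [hB, ← map_pow, Matrix.linfty_opNorm_def, Matrix.linfty_opNorm_def]
    simp
  simp_rw [hnorm]
  exact (summable_nat_add_iff 1).2 hsumB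

/-- There are only finitely many integer points in `∑_{r ≥ 1} M^{-r} G` if `M` is expanding. -/
theorem latticeAttractor_finite {s : ℕ} {M : Matrix (Fin s) (Fin s) ℤ} (hM : IsExpanding M)
    (G : Finset (Fin s → ℤ)) : (latticeAttractor M G).Finite := by
  have hsum := summable_norm_pow_inv hM
  set C : ℝ := ∑ g ∈ G, ‖toRealVec g‖ with hC
  set S : ℝ := ∑' r : ℕ, ‖((realMatrix M)⁻¹) ^ (r + 1)‖ * C with hS
  refine (Set.finite_Icc (fun _ : Fin s => -⌈S⌉) (fun _ => ⌈S⌉)).subset ?_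
  rintro α ⟨g, hg, hα⟩
  have hle : ∀ r : ℕ, ‖((realMatrix M)⁻¹) ^ (r + 1) *ᵥ toRealVec (g r)‖ ≤
      ‖((realMatrix M)⁻¹) ^ (r + 1)‖ * C := by
    intro r
    refine (Matrix.linfty_opNorm_mulVec _ _).trans ?_
    refine mul_le_mul_of_nonneg_left ?_ (norm_nonneg _)
    exact Finset.single_le_sum (f := fun g => ‖toRealVec g‖) (fun _ _ => norm_nonneg _) (hg r)
  have hbound : ‖toRealVec α‖ ≤ S := by
    rw [← hα.tsum_eq]
    exact tsum_of_norm_bounded (hsum.mul_right C).hasSum hle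
  have hj : ∀ j, |α j| ≤ ⌈S⌉ := by
    intro j
    have h1 : |(α j : ℝ)| ≤ S := (norm_le_pi_norm (toRealVec α) j).trans hbound
    have h2 : |(α j : ℝ)| ≤ (⌈S⌉ : ℝ) := h1.trans (Int.le_ceil S)
    exact_mod_cast h2
  exact ⟨fun j => (abs_le.1 (hj j)).1, fun j => (abs_le.1 (hj j)).2⟩

end Finiteness

/-- The digits `G = {0, …, N}^s - E + {-1, 0, 1}^s`. For `M = mI` and `E = {0, …, m-1}^s` this is
`{-m, …, N+1}^s`. -/
noncomputable def digitSet {s : ℕ} (N : ℕ) (E : Finset (Fin s → ℤ)) : Finset (Fin s → ℤ) :=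
  Finset.Icc (0 : Fin s → ℤ) (fun _ => (N : ℤ)) - E + Finset.Icc (-1 : Fin s → ℤ) 1

/-- The index set `K = ℤ^s ∩ ∑_{r ≥ 1} M^{-r} G`. -/
noncomputable def indexSet {s : ℕ} {M : Matrix (Fin s) (Fin s) ℤ} (hM : IsExpanding M) (N : ℕ)
    (E : Finset (Fin s → ℤ)) : Finset (Fin s → ℤ) :=
  (latticeAttractor_finite hM (digitSet N E)).toFinset

/-! ### Transition matrices and joint spectral radius -/

/-- The transition matrix `[b(ε + Mα - β)]_{α, β ∈ K}`. -/
def transitionMatrix {s : ℕ} (M : Matrix (Fin s) (Fin s) ℤ) (K : Finset (Fin s → ℤ))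
    (b : (Fin s → ℤ) → ℝ) (ε : Fin s → ℤ) : Matrix K K ℝ :=
  Matrix.of fun α β => b (ε + M *ᵥ (α : Fin s → ℤ) - (β : Fin s → ℤ))

/-- The vectors indexed by `K` whose entries sum to zero. -/
def zeroSumSubspace {s : ℕ} (K : Finset (Fin s → ℤ)) : Submodule ℝ (K → ℝ) where
  carrier := {v | ∑ α, v α = 0}
  zero_mem' := by simp
  add_mem' := by
    intro v w hv hw
    simp only [Set.mem_ofPred_eq, Pi.add_apply, Finset.sum_add_distrib] at *
    rw [hv, hw, add_zero]
  smul_mem' := by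
    intro t v hv
    simp only [Set.mem_ofPred_eq, Pi.smul_apply, smul_eq_mul, ← Finset.mul_sum] at *
    rw [hv, mul_zero]

/-- The restrictions to the zero-sum subspace of the transition matrices of the masks in `A`. -/
def restrictedTransitions {s : ℕ} (M : Matrix (Fin s) (Fin s) ℤ) (K E : Finset (Fin s → ℤ))
    (A : Set ((Fin s → ℤ) → ℝ)) : Set (zeroSumSubspace K →L[ℝ] zeroSumSubspace K) :=
  {T | ∃ b ∈ A, ∃ ε ∈ E, ∀ v : zeroSumSubspace K,
    ((T v : zeroSumSubspace K) : K → ℝ) = transitionMatrix M K b ε *ᵥ (v : K → ℝ)}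

/-- The joint spectral radius `lim_n sup {‖T_1 ⋯ T_n‖^{1/n}}` of a set of operators, with values in
`[0, ∞]`; the `limsup` is a limit when the set is bounded, by submultiplicativity. -/
noncomputable def jointSpectralRadius {V : Type*} [NormedAddCommGroup V] [NormedSpace ℝ V]
    (𝓣 : Set (V →L[ℝ] V)) : ℝ≥0∞ :=
  limsup (fun n : ℕ => ⨆ T : Fin n → 𝓣,
    ‖(List.ofFn fun i => (T i : V →L[ℝ] V)).prod‖ₑ ^ (1 / (n : ℝ))) atTop

/-! Let `c_k` be the data after `k` steps. In the coordinates `Mγ + ε - β`, one step with mask `b`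
is `(S_b c)(Mγ + ε - β) = ∑_x b(ε + Mx - β) c(γ - x)`, so a functional `v` of the new values on `Mγ
+ ε - K` is the functional `T_{ε,b} v` of the old values on `γ - K`. This closes up because `K` is
invariant (`sourceSet_indexSet_subset`). Functionals in `V₀` annihilate constants and measure
oscillation.

Fourier inversion on `ℤ^s / Mℤ^s` turns the defects at the points of `Ξ` into a bound for the
deviation of every coset sum of a mask from `1` (`abs_sum_coset_sub_one_le`). Hence limit masks have
exact coset sums, their matrices preserve `V₀`, and the spectral radius condition yields a gauge `p`
on `V₀` contracted by all of them (`exists_contracting_gauge`).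

By compactness the masks of high levels are uniformly close to limit masks, so they contract `p`
too, up to an error from leaving `V₀` that is proportional to the sum rule error `η_k`
(`abs_sum_mul_subdivision_le`). For the size `x_k` of the data and their oscillation `y_k` this
gives `x_{k+1} ≤ (1 + Aη_k) x_k + A y_k` and `y_{k+1} ≤ q y_k + Aη_k x_k` with `q < 1` and summable
`η`, whence `x` is bounded and `y` summable (`exists_bound_of_recursive_le`).

Summable oscillation passes from `K` to every finite set, because tracing dependencies back through
finitely many levels leads into `K` (`exists_iterate_sourceSet_subset`). So the step functions
`c_k(⌊M^k x⌋)` have summable increments and vanishing jumps, and converge uniformly to a continuous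
limit. A test function gives the same limit: the Strang-Fix conditions make its translates a
partition of unity by Fourier series on the torus (`finsum_translates_eq_one`), so its sum differs
from the step function by a local oscillation of `c_k`. -/

section Lattice

variable {s : ℕ} {M : Matrix (Fin s) (Fin s) ℤ}

/-! ### Expanding integer matrices -/

theorem IsExpanding.det_ne_zero (hM : IsExpanding M) : M.det ≠ 0 := by
  intro h
  have h0 : (0 : ℂ) ∈ spectrum ℂ (M.map (Int.cast : ℤ → ℂ)) := by
    refine spectrum.zero_mem_iff ℂ |>.2 fun hu => ?_
    rw [Matrix.isUnit_iff_isUnit_det] at hu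
    have h1 : (M.map (Int.cast : ℤ → ℂ)).det = ((M.det : ℤ) : ℂ) :=
      ((Int.castRingHom ℂ).map_det M).symm
    rw [h1, h] at hu
    simp at hu
  have := hM 0 h0
  simp at this
  linarith

theorem IsExpanding.isUnit_det_realMatrix (hM : IsExpanding M) : IsUnit (realMatrix M).det := by
  have h1 : (realMatrix M).det = ((M.det : ℤ) : ℝ) := ((Int.castRingHom ℝ).map_det M).symm
  rw [h1, isUnit_iff_ne_zero]
  exact_mod_cast hM.det_ne_zero

theorem IsExpanding.mulVec_injective (hM : IsExpanding M) :
    Function.Injective fun x : Fin s → ℤ => M *ᵥ x := by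
  intro x y hxy
  have h : M *ᵥ (x - y) = 0 := by rw [Matrix.mulVec_sub]; exact sub_eq_zero.2 hxy
  exact sub_eq_zero.1 (Matrix.eq_zero_of_mulVec_eq_zero hM.det_ne_zero h)

theorem toRealVec_mulVec (x : Fin s → ℤ) :
    toRealVec (M *ᵥ x) = realMatrix M *ᵥ toRealVec x := by
  ext j
  simp [toRealVec, realMatrix, Matrix.mulVec, dotProduct]

theorem toRealVec_add (x y : Fin s → ℤ) : toRealVec (x + y) = toRealVec x + toRealVec y := by
  ext j; simp [toRealVec]

theorem toRealVec_sub (x y : Fin s → ℤ) : toRealVec (x - y) = toRealVec x - toRealVec y := by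
  ext j; simp [toRealVec]

theorem inv_pow_succ_mulVec_toRealVec (hM : IsExpanding M) (n : ℕ) (x : Fin s → ℤ) :
    (realMatrix M)⁻¹ ^ (n + 1) *ᵥ toRealVec (M *ᵥ x) = (realMatrix M)⁻¹ ^ n *ᵥ toRealVec x := by
  rw [toRealVec_mulVec, Matrix.mulVec_mulVec, pow_succ, mul_assoc,
    Matrix.nonsing_inv_mul _ hM.isUnit_det_realMatrix, mul_one]

theorem finite_setOf_norm_toRealVec_le (C : ℝ) : {x : Fin s → ℤ | ‖toRealVec x‖ ≤ C}.Finite := by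
  refine (Set.finite_Icc (fun _ : Fin s => -⌈C⌉) (fun _ => ⌈C⌉)).subset ?_
  intro x hx
  have hj : ∀ j, |x j| ≤ ⌈C⌉ := by
    intro j
    have h1 : |(x j : ℝ)| ≤ C := (norm_le_pi_norm (toRealVec x) j).trans hx
    exact_mod_cast h1.trans (Int.le_ceil C)
  exact ⟨fun j => (abs_le.1 (hj j)).1, fun j => (abs_le.1 (hj j)).2⟩

/-! ### Index sets -/

section

attribute [local instance] Matrix.linftyOpNormedRing Matrix.linftyOpNormedAlgebra

theorem norm_mulVec_le_of_le (A : Matrix (Fin s) (Fin s) ℝ) {v : Fin s → ℝ} {C : ℝ}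
    (h : ‖v‖ ≤ C) : ‖A *ᵥ v‖ ≤ ‖A‖ * C :=
  (Matrix.linfty_opNorm_mulVec A v).trans (mul_le_mul_of_nonneg_left h (norm_nonneg A))

/-- A finite set of lattice points, each of which has a predecessor in the set, is contained in
the attractor. -/
theorem subset_latticeAttractor (hM : IsExpanding M) {G : Finset (Fin s → ℤ)}
    {A : Set (Fin s → ℤ)} (hA : A.Finite) (h : ∀ x ∈ A, ∃ y ∈ A, M *ᵥ x - y ∈ G) :
    A ⊆ latticeAttractor M G := by
  intro x hx
  choose! next hnext hG using h
  have hmem : ∀ n, next^[n] x ∈ A := by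
    intro n
    induction n with
    | zero => exact hx
    | succ n ih => rw [Function.iterate_succ_apply']; exact hnext _ ih
  obtain ⟨C, hC⟩ : ∃ C, ∀ y ∈ A, ‖toRealVec y‖ ≤ C := by
    obtain ⟨C, hC⟩ := (hA.image fun y => ‖toRealVec y‖).bddAbove
    exact ⟨C, fun y hy => hC ⟨y, hy, rfl⟩⟩
  have hsum := summable_norm_pow_inv hM
  -- Iterating `x = M⁻¹(g₀ + next x)` yields the digit expansion. The remainder `M⁻ⁿ next^[n] x`
  -- vanishes in the limit since the orbit stays in the bounded set `A`.
  set g : ℕ → Fin s → ℤ := fun n => M *ᵥ (next^[n] x) - next^[n + 1] x with hg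
  have hgG : ∀ n, g n ∈ G := by
    intro n
    simp only [hg, Function.iterate_succ_apply']
    exact hG _ (hmem n)
  refine ⟨g, hgG, ?_⟩
  have hpart : ∀ n, ∑ r ∈ Finset.range n, (realMatrix M)⁻¹ ^ (r + 1) *ᵥ toRealVec (g r) =
      toRealVec x - (realMatrix M)⁻¹ ^ n *ᵥ toRealVec (next^[n] x) := by
    intro n
    induction n with
    | zero => simp
    | succ n ih =>
      rw [Finset.sum_range_succ, ih, hg, toRealVec_sub, Matrix.mulVec_sub,
        inv_pow_succ_mulVec_toRealVec hM]
      abel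
  have hs : Summable fun r => (realMatrix M)⁻¹ ^ (r + 1) *ᵥ toRealVec (g r) := by
    refine Summable.of_norm_bounded
      (hsum.mul_right (∑ y ∈ G, ‖toRealVec y‖)) fun r => ?_
    refine norm_mulVec_le_of_le _ ?_
    exact Finset.single_le_sum (f := fun g => ‖toRealVec g‖) (fun _ _ => norm_nonneg _) (hgG r)
  rw [hs.hasSum_iff_tendsto_nat]
  simp_rw [hpart]
  have h0 : Tendsto (fun n => (realMatrix M)⁻¹ ^ n *ᵥ toRealVec (next^[n] x)) atTop (𝓝 0) := by
    have h1 : Summable fun n => ‖(realMatrix M)⁻¹ ^ n‖ :=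
      (summable_nat_add_iff (f := fun n => ‖(realMatrix M)⁻¹ ^ n‖) 1).1 hsum
    have h2 := h1.tendsto_atTop_zero.mul_const C
    rw [zero_mul] at h2
    exact squeeze_zero_norm (fun n => norm_mulVec_le_of_le _ (hC _ (hmem n))) h2
  simpa using tendsto_const_nhds.sub h0

/-- The points that are needed at one level of the subdivision to compute the points `-β`, `β ∈ F`,
of the next one. -/
def sourceSet (M : Matrix (Fin s) (Fin s) ℤ) (E : Finset (Fin s → ℤ)) (N : ℕ)
    (F : Set (Fin s → ℤ)) : Set (Fin s → ℤ) :=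
  {x | ∃ ε ∈ E, ∃ β ∈ F, ε + M *ᵥ x - β ∈ Set.Icc (0 : Fin s → ℤ) fun _ => (N : ℤ)}

theorem mulVec_sub_mem_digitSet {E : Finset (Fin s → ℤ)} {N : ℕ} {ε x β : Fin s → ℤ}
    (hε : ε ∈ E) (h : ε + M *ᵥ x - β ∈ Set.Icc (0 : Fin s → ℤ) fun _ => (N : ℤ)) :
    M *ᵥ x - β ∈ digitSet N E := by
  -- The summand `{-1, 0, 1}^s` of the digit set contributes the digit `0` here.
  have h1 : M *ᵥ x - β = (ε + M *ᵥ x - β - ε) + 0 := by abel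
  rw [h1]
  refine Finset.add_mem_add (Finset.sub_mem_sub (Finset.mem_Icc.2 h) hε) ?_
  refine Finset.mem_Icc.2 ⟨fun j => ?_, fun j => ?_⟩ <;> simp

variable {E : Finset (Fin s → ℤ)} {N : ℕ}

theorem finite_sourceSet (hM : IsExpanding M) {F : Set (Fin s → ℤ)} (hF : F.Finite) :
    (sourceSet M E N F).Finite := by
  refine (((digitSet N E).finite_toSet.add hF).preimage
    (hM.mulVec_injective.injOn)).subset ?_
  rintro x ⟨ε, hε, β, hβ, hx⟩
  exact ⟨_, mulVec_sub_mem_digitSet hε hx, β, hβ, by simp⟩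

/-- A source `x` of `β` satisfies `x = M⁻¹(β + g)` with a digit `g`, so an `n`-fold source is `M⁻ⁿ
y`, `y ∈ F`, plus a partial digit expansion. Both are bounded independently of `n`. -/
theorem finite_iUnion_iterate_sourceSet (hM : IsExpanding M) {F : Set (Fin s → ℤ)}
    (hF : F.Finite) : (⋃ n, (sourceSet M E N)^[n] F).Finite := by
  have hsum := summable_norm_pow_inv hM
  obtain ⟨C, hC⟩ : ∃ C, ∀ y ∈ F, ‖toRealVec y‖ ≤ C := by
    obtain ⟨C, hC⟩ := (hF.image fun y => ‖toRealVec y‖).bddAbove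
    exact ⟨C, fun y hy => hC ⟨y, hy, rfl⟩⟩
  set D : ℝ := ∑ g ∈ digitSet N E, ‖toRealVec g‖ with hD
  have hD0 : 0 ≤ D := Finset.sum_nonneg fun _ _ => norm_nonneg _
  set p : ℕ → ℝ := fun n => ‖(realMatrix M)⁻¹ ^ n‖ with hp
  -- The extra power `m` makes the induction produce norms of powers of `M⁻¹`, which are summable;
  -- `‖M⁻¹‖` itself may exceed `1`.
  have key : ∀ n, ∀ x ∈ (sourceSet M E N)^[n] F, ∀ m,
      ‖(realMatrix M)⁻¹ ^ m *ᵥ toRealVec x‖ ≤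
        p (m + n) * C + ∑ r ∈ Finset.range n, p (m + r + 1) * D := by
    intro n
    induction n with
    | zero =>
      intro x hx m
      simp only [Finset.range_zero, Finset.sum_empty, add_zero, hp]
      exact norm_mulVec_le_of_le ((realMatrix M)⁻¹ ^ m) (hC _ hx)
    | succ n ih =>
      intro x hx m
      rw [Function.iterate_succ_apply'] at hx
      obtain ⟨ε, hε, β, hβ, hx⟩ := hx
      have hg := mulVec_sub_mem_digitSet hε hx
      have h1 : (realMatrix M)⁻¹ ^ m *ᵥ toRealVec x =
          (realMatrix M)⁻¹ ^ (m + 1) *ᵥ toRealVec β +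
            (realMatrix M)⁻¹ ^ (m + 1) *ᵥ toRealVec (M *ᵥ x - β) := by
        rw [← inv_pow_succ_mulVec_toRealVec hM, ← Matrix.mulVec_add, ← toRealVec_add]
        congr 2
        abel
      have h2 : ‖(realMatrix M)⁻¹ ^ (m + 1) *ᵥ toRealVec (M *ᵥ x - β)‖ ≤ p (m + 1) * D :=
        norm_mulVec_le_of_le _
          (Finset.single_le_sum (f := fun g => ‖toRealVec g‖) (fun _ _ => norm_nonneg _) hg)
      rw [h1, Finset.sum_range_succ']
      refine (norm_add_le _ _).trans ?_
      have h3 := ih β hβ (m + 1)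
      have e1 : m + 1 + n = m + (n + 1) := by ring
      have e2 : ∀ r, m + 1 + r + 1 = m + (r + 1) + 1 := fun r => by ring
      simp only [e1, e2] at h3
      simp only [add_zero]
      linarith
  have hp0 : ∀ n, 0 ≤ p n := fun n => norm_nonneg _
  have hsum' : Summable p := (summable_nat_add_iff 1).1 hsum
  refine (finite_setOf_norm_toRealVec_le ((∑' n, p n) * |C| + ∑' n, p (n + 1) * D)).subset ?_
  intro x hx
  obtain ⟨n, hn⟩ := Set.mem_iUnion.1 hx
  have h1 := key n x hn 0
  simp only [pow_zero, Matrix.one_mulVec, zero_add] at h1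
  refine h1.trans (add_le_add ?_ ?_)
  · exact (mul_le_mul_of_nonneg_left (le_abs_self C) (hp0 n)).trans
      (mul_le_mul_of_nonneg_right (hsum'.le_tsum n fun _ _ => hp0 _) (abs_nonneg C))
  · exact Summable.sum_le_tsum _ (fun _ _ => mul_nonneg (hp0 _) hD0) (hsum.mul_right D)

end

variable {E : Finset (Fin s → ℤ)} {N : ℕ}

/-- The tails `U n` of the iterated source sets form a decreasing sequence of finite sets, hence
become stationary. In a stationary tail each point is a source of another point of the tail, so the
tail lies in the attractor. -/
theorem exists_iterate_sourceSet_subset (hM : IsExpanding M) {F : Set (Fin s → ℤ)}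
    (hF : F.Finite) : ∃ n, (sourceSet M E N)^[n] F ⊆ indexSet hM N E := by
  set R : ℕ → Set (Fin s → ℤ) := fun n => (sourceSet M E N)^[n] F with hR
  set U : ℕ → Set (Fin s → ℤ) := fun n => ⋃ m ≥ n, R m with hU
  have hfin : ∀ n, (U n).Finite := fun n =>
    (finite_iUnion_iterate_sourceSet hM hF).subset
      (Set.iUnion₂_subset fun m _ => Set.subset_iUnion R m)
  have hanti : ∀ n, U (n + 1) ⊆ U n := fun n =>
    Set.biUnion_subset_biUnion_left fun m (hm : n + 1 ≤ m) => (Nat.le_succ n).trans hm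
  obtain ⟨n, hn⟩ : ∃ n, U (n + 1) = U n := by
    by_contra! hne
    have hlt : StrictAnti fun n => (U n).ncard := strictAnti_nat_of_succ_lt fun n =>
      Set.ncard_lt_ncard ((hanti n).ssubset_of_ne (hne n)) (hfin n)
    exact WellFounded.not_rel_apply_succ (r := (· < ·)) (fun n => (U n).ncard) |>.elim
      fun k hk => hk (hlt (Nat.lt_succ_self k))
  refine ⟨n, fun x hx => ?_⟩
  have hxU : x ∈ U n := Set.mem_biUnion (le_refl n) hx
  simp only [indexSet, Set.Finite.coe_toFinset]
  refine subset_latticeAttractor hM (hfin n) (fun y hy => ?_) hxU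
  rw [← hn] at hy
  obtain ⟨m, hm, hym⟩ := Set.mem_iUnion₂.1 hy
  obtain ⟨m, rfl⟩ : ∃ k, m = k + 1 := ⟨m - 1, by omega⟩
  simp only [hR, Function.iterate_succ_apply'] at hym
  obtain ⟨ε, hε, β, hβ, hyβ⟩ := hym
  exact ⟨β, Set.mem_biUnion (show n ≤ m by omega) hβ, mulVec_sub_mem_digitSet hε hyβ⟩

/-- A property of sets of lattice points which holds for the index set and passes to subsets and
from `sourceSet F` to `F`, holds for all finite sets. -/
theorem finite_induction_sourceSet (hM : IsExpanding M) {P : Set (Fin s → ℤ) → Prop}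
    (hK : P (indexSet hM N E)) (hmono : ∀ A B, A ⊆ B → P B → P A)
    (hstep : ∀ F : Set (Fin s → ℤ), F.Finite → P (sourceSet M E N F) → P F)
    {F : Set (Fin s → ℤ)} (hF : F.Finite) : P F := by
  obtain ⟨n, hn⟩ := exists_iterate_sourceSet_subset (E := E) (N := N) hM hF
  have hP := hmono _ _ hn hK
  clear hn
  induction n generalizing F with
  | zero => exact hP
  | succ n ih =>
    rw [Function.iterate_succ_apply] at hP
    exact hstep F hF (ih (finite_sourceSet hM hF) hP)

theorem nonempty_sourceSet (hE : IsCosetReps M E) {F : Set (Fin s → ℤ)} (hF : F.Nonempty) :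
    (sourceSet M E N F).Nonempty := by
  obtain ⟨β, hβ⟩ := hF
  obtain ⟨ε, ⟨hε, x, hx⟩, -⟩ := hE β
  refine ⟨x, ε, hε, β, hβ, ?_⟩
  rw [← hx, sub_self]
  exact ⟨le_refl _, fun j => by simp⟩

/-- Source sets of nonempty sets are nonempty, and those of `{0}` end up inside the index set. -/
theorem nonempty_indexSet (hM : IsExpanding M) (hE : IsCosetReps M E) :
    (indexSet hM N E).Nonempty := by
  have h := finite_induction_sourceSet (N := N) (E := E) hM
    (P := fun F => F.Nonempty → (indexSet hM N E).Nonempty)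
    (fun h => by simpa using h) (fun A B hAB hB hA => hB (hA.mono hAB))
    (fun F _ h hF => h (nonempty_sourceSet hE hF)) (Set.finite_singleton 0)
  exact h (Set.singleton_nonempty 0)

/-- The index set is invariant. -/
theorem sourceSet_indexSet_subset (hM : IsExpanding M) :
    sourceSet M E N (indexSet hM N E) ⊆ indexSet hM N E := by
  rintro x ⟨ε, hε, β, hβ, hx⟩
  simp only [indexSet, Set.Finite.coe_toFinset] at hβ ⊢
  obtain ⟨g, hg, hs⟩ := hβ
  -- Since `x = M⁻¹(Mx - β) + M⁻¹β`, prepending the digit `Mx - β` to an expansion of `β` gives one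
  -- of `x`.
  refine ⟨fun n => Nat.casesOn n (M *ᵥ x - β) g, fun n => ?_, ?_⟩
  · cases n with
    | zero => exact mulVec_sub_mem_digitSet hε hx
    | succ n => exact hg n
  · rw [← hasSum_nat_add_iff' 1]
    have h1 := hs.map (Matrix.mulVecLin (realMatrix M)⁻¹)
      (Continuous.matrix_mulVec continuous_const continuous_id)
    have h2 := inv_pow_succ_mulVec_toRealVec hM 0 x
    rw [zero_add, pow_one, pow_zero, Matrix.one_mulVec] at h2
    rw [Finset.sum_range_one, zero_add, pow_one]
    change HasSum (fun n => (realMatrix M)⁻¹ ^ (n + 1 + 1) *ᵥ toRealVec (g n))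
      (toRealVec x - (realMatrix M)⁻¹ *ᵥ toRealVec (M *ᵥ x - β))
    rw [toRealVec_sub, Matrix.mulVec_sub, h2, sub_sub_cancel]
    convert! h1 using 1
    funext n
    simp only [Function.comp_apply, Matrix.mulVecLin_apply, Matrix.mulVec_mulVec, ← pow_succ']

end Lattice

section SumRules

variable {s : ℕ} {M : Matrix (Fin s) (Fin s) ℤ} {N : ℕ} {b : (Fin s → ℤ) → ℝ}

/-! ### Approximate sum rules on cosets -/

theorem symbol_eq_sum (hb : SupportedOnBox N b) (z : Fin s → ℂ) :
    symbol b z = ∑ α ∈ Finset.Icc (0 : Fin s → ℤ) (fun _ => (N : ℤ)),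
      (b α : ℂ) * ∏ j, z j ^ α j := by
  refine finsum_eq_sum_of_support_subset _ fun α hα => ?_
  have h : b α ≠ 0 := by
    intro h
    simp [h] at hα
  exact Finset.mem_coe.2 (Finset.mem_Icc.2 ⟨fun j => (hb α h j).1, fun j => (hb α h j).2⟩)

theorem norm_eq_one_of_mem_dualPoints {z : Fin s → ℂ} (hz : z ∈ dualPoints M) (j : Fin s) :
    ‖z j‖ = 1 := by
  obtain ⟨ξ, rfl⟩ := hz
  have h := Complex.norm_exp_ofReal_mul_I (2 * Real.pi * ((realMatrix M)ᵀ⁻¹ *ᵥ toRealVec ξ) j)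
  rw [← h]
  congr 2
  push_cast
  ring_nf

theorem norm_symbol_le_sumRuleDefect (hb : SupportedOnBox N b) {z : Fin s → ℂ}
    (hz : z ∈ dualPoints M) (hz1 : z ≠ 1) : ‖symbol b z‖ ≤ sumRuleDefect M b := by
  refine le_csSup ⟨∑ α ∈ Finset.Icc (0 : Fin s → ℤ) (fun _ => (N : ℤ)), |b α|, ?_⟩
    ⟨z, ⟨hz, hz1⟩, rfl⟩
  rintro _ ⟨w, ⟨hw, -⟩, rfl⟩
  simp only [symbol_eq_sum hb]
  refine (norm_sum_le _ _).trans (Finset.sum_le_sum fun α _ => ?_)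
  rw [norm_mul, norm_prod]
  simp [norm_zpow, norm_eq_one_of_mem_dualPoints hw]

theorem sumRuleDefect_nonneg : 0 ≤ sumRuleDefect M b := by
  refine Real.sSup_nonneg ?_
  rintro _ ⟨w, -, rfl⟩
  exact norm_nonneg _

theorem massDefect_nonneg : 0 ≤ massDefect M b := norm_nonneg _

/-- The deviation from the sum rules which is summable for masks with approximate sum rules. -/
noncomputable def sumRuleError (M : Matrix (Fin s) (Fin s) ℤ) (b : (Fin s → ℤ) → ℝ) : ℝ :=
  massDefect M b + |(M.det : ℝ)| * sumRuleDefect M b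

theorem sumRuleError_nonneg : 0 ≤ sumRuleError M b :=
  add_nonneg massDefect_nonneg (mul_nonneg (abs_nonneg _) sumRuleDefect_nonneg)

theorem card_quotient_range_mulVecLin (hM : IsExpanding M) :
    Nat.card ((Fin s → ℤ) ⧸ LinearMap.range M.mulVecLin) = M.det.natAbs := by
  rw [← Submodule.natAbs_det_equiv _
    (LinearEquiv.ofInjective M.mulVecLin hM.mulVec_injective), ← LinearMap.det_toLin']
  congr 2

/-! ### Characters of `ℤ^s / Mℤ^s` as points of `Ξ`. -/

section Characters

variable (ψ : AddChar ((Fin s → ℤ) ⧸ LinearMap.range M.mulVecLin) ℂ)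

/-- The values of a character on the standard basis. -/
noncomputable def characterPoint (j : Fin s) : ℂ := ψ (Submodule.Quotient.mk (Pi.single j 1))

/-- Makes the symbol at `characterPoint ψ` equal to the character sum `∑ b(α) ψ(α)`. -/
theorem character_apply_eq_prod (α : Fin s → ℤ) :
    ψ (Submodule.Quotient.mk α) = ∏ j, characterPoint ψ j ^ α j := by
  have h : (Submodule.Quotient.mk α : (Fin s → ℤ) ⧸ LinearMap.range M.mulVecLin) =
      ∑ j, α j • Submodule.Quotient.mk (Pi.single j 1) := by
    simp_rw [← Submodule.Quotient.mk_smul, ← Submodule.mkQ_apply, ← map_sum]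
    congr 1
    ext i
    simp [Finset.sum_apply, Pi.single_apply]
  have h2 : ∀ (S : Finset (Fin s)) (f : Fin s → (Fin s → ℤ) ⧸ LinearMap.range M.mulVecLin),
      ψ (∑ j ∈ S, f j) = ∏ j ∈ S, ψ (f j) := fun S f =>
    map_prod ψ.toMonoidHom (fun j => Multiplicative.ofAdd (f j)) S
  rw [h, h2]
  simp [AddChar.map_zsmul_eq_zpow, characterPoint]

/-- Characters of a finite group have unimodular values, so the point is `exp(2πiθ)`. Triviality of
`ψ` on the columns of `M` means `Mᵀθ ∈ ℤ^s`, that is, `θ = M^{-T}ξ`. -/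
theorem characterPoint_mem_dualPoints (hM : IsExpanding M) :
    characterPoint ψ ∈ dualPoints M := by
  have hfin : Finite ((Fin s → ℤ) ⧸ LinearMap.range M.mulVecLin) := by
    refine Nat.finite_of_card_ne_zero ?_
    rw [card_quotient_range_mulVecLin hM]
    exact Int.natAbs_ne_zero.2 hM.det_ne_zero
  set θ : Fin s → ℝ := fun j => (characterPoint ψ j).arg / (2 * Real.pi) with hθ
  have hz : ∀ j, characterPoint ψ j = Complex.exp (2 * Real.pi * Complex.I * (θ j : ℂ)) := by
    intro j
    have h1 : ‖characterPoint ψ j‖ = 1 := AddChar.norm_apply _ _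
    have h2 := Complex.norm_mul_exp_arg_mul_I (characterPoint ψ j)
    rw [h1, Complex.ofReal_one, one_mul] at h2
    conv_lhs => rw [← h2]
    congr 1
    have : (Real.pi : ℂ) ≠ 0 := by exact_mod_cast Real.pi_ne_zero
    simp only [hθ]
    push_cast
    field_simp
  have hint : ∀ i, ∃ n : ℤ, ((realMatrix M)ᵀ *ᵥ θ) i = n := by
    intro i
    have h1 : ψ (Submodule.Quotient.mk (M *ᵥ Pi.single i 1)) = 1 := by
      have : (Submodule.Quotient.mk (M *ᵥ Pi.single i 1) :
          (Fin s → ℤ) ⧸ LinearMap.range M.mulVecLin) = 0 :=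
        (Submodule.Quotient.mk_eq_zero _).2 ⟨Pi.single i 1, rfl⟩
      rw [this, AddChar.map_zero_eq_one]
    rw [character_apply_eq_prod] at h1
    simp_rw [hz, ← Complex.exp_int_mul, ← Complex.exp_sum] at h1
    obtain ⟨n, hn⟩ := Complex.exp_eq_one_iff.1 h1
    refine ⟨n, ?_⟩
    have hpi : (2 * Real.pi * Complex.I : ℂ) ≠ 0 := Complex.two_pi_I_ne_zero
    have h2 : ((((realMatrix M)ᵀ *ᵥ θ) i : ℝ) : ℂ) = n := by
      apply mul_right_cancel₀ hpi
      rw [← hn]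
      simp only [Matrix.mulVec, dotProduct, realMatrix, Matrix.transpose_apply, Matrix.map_apply,
        Complex.ofReal_sum, Finset.sum_mul]
      refine Finset.sum_congr rfl fun j _ => ?_
      simp [Pi.single_apply]
      ring
    exact_mod_cast h2
  choose ξ hξ using hint
  refine ⟨ξ, ?_⟩
  have h : (realMatrix M)ᵀ⁻¹ *ᵥ toRealVec ξ = θ := by
    have : toRealVec ξ = (realMatrix M)ᵀ *ᵥ θ := funext fun i => (hξ i).symm
    rw [this, Matrix.mulVec_mulVec, Matrix.nonsing_inv_mul, Matrix.one_mulVec]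
    rw [Matrix.det_transpose]
    exact hM.isUnit_det_realMatrix
  rw [h]
  exact funext hz

theorem characterPoint_ne_one (hψ : ψ ≠ 0) : characterPoint ψ ≠ 1 := by
  intro h
  refine hψ (DFunLike.ext _ _ fun x => ?_)
  induction x using Submodule.Quotient.induction_on with
  | _ α => simp [character_apply_eq_prod, h]

end Characters

/-- Masks with small defects almost satisfy the sum rules on each coset. -/
theorem abs_sum_coset_sub_one_le (hM : IsExpanding M) (hb : SupportedOnBox N b) (ε : Fin s → ℤ)
    {F : Finset (Fin s → ℤ)} (hF : ∀ x, b (ε + M *ᵥ x) ≠ 0 → x ∈ F) :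
    |∑ x ∈ F, b (ε + M *ᵥ x) - 1| ≤ sumRuleError M b := by
  classical
  set Q := (Fin s → ℤ) ⧸ LinearMap.range M.mulVecLin with hQ
  have hcard := card_quotient_range_mulVecLin hM
  have hfin : Finite Q := by
    refine Nat.finite_of_card_ne_zero ?_
    rw [hcard]
    exact Int.natAbs_ne_zero.2 hM.det_ne_zero
  have := Fintype.ofFinite Q
  set m : ℝ := |(M.det : ℝ)| with hm
  have hm1 : 1 ≤ m := by
    have := Int.one_le_abs hM.det_ne_zero
    rw [hm]
    exact_mod_cast this
  have hcardm : (Fintype.card Q : ℝ) = m := by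
    rw [← Nat.card_eq_fintype_card, hcard, Nat.cast_natAbs, hm]
    push_cast
    rfl
  have hcardm' : (Fintype.card Q : ℂ) = (m : ℂ) := by rw [← hcardm]; simp
  set B := Finset.Icc (0 : Fin s → ℤ) (fun _ => (N : ℤ)) with hB
  have hBmem : ∀ α, b α ≠ 0 → α ∈ B := fun α h =>
    Finset.mem_Icc.2 ⟨fun j => (hb α h j).1, fun j => (hb α h j).2⟩
  have hcoset : ∑ α ∈ B, (if (Submodule.Quotient.mk (α - ε) : Q) = 0 then b α else 0) =
      ∑ x ∈ F, b (ε + M *ᵥ x) := by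
    rw [← Finset.sum_filter]
    symm
    refine Finset.sum_bij_ne_zero (fun x _ _ => ε + M *ᵥ x) ?_ ?_ ?_ ?_
    · intro x _ hx
      refine Finset.mem_filter.2 ⟨hBmem _ hx, ?_⟩
      rw [Submodule.Quotient.mk_eq_zero, add_sub_cancel_left]
      exact ⟨x, rfl⟩
    · intro x _ _ y _ _ hxy
      exact hM.mulVec_injective (add_left_cancel hxy)
    · intro α hα hα0
      obtain ⟨x, hx⟩ := (Submodule.Quotient.mk_eq_zero _).1 (Finset.mem_filter.1 hα).2
      have hx' : ε + M *ᵥ x = α := by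
        rw [Matrix.mulVecLin_apply] at hx
        rw [hx]
        abel
      exact ⟨x, hF x (by rwa [hx']), by rwa [hx'], hx'⟩
    · intro _ _ _
      rfl
  -- Fourier inversion: averaging over all characters with the weights `ψ(-ε)` singles out the coset
  -- of `ε`.
  have hchar : ∑ ψ : AddChar Q ℂ, ψ (Submodule.Quotient.mk (-ε)) * symbol b (characterPoint ψ) =
      (m : ℂ) * (∑ x ∈ F, b (ε + M *ᵥ x) : ℝ) := by
    simp_rw [symbol_eq_sum hb, ← character_apply_eq_prod, Finset.mul_sum]
    rw [Finset.sum_comm, ← hcoset, Complex.ofReal_sum, Finset.mul_sum]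
    refine Finset.sum_congr rfl fun α _ => ?_
    have h1 := AddChar.sum_apply_eq_ite (Submodule.Quotient.mk (α - ε) : Q)
    have h2 : ∀ ψ : AddChar Q ℂ, ψ (Submodule.Quotient.mk (α - ε)) =
        ψ (Submodule.Quotient.mk (-ε)) * ψ (Submodule.Quotient.mk α) := by
      intro ψ
      rw [← AddChar.map_add_eq_mul, ← Submodule.Quotient.mk_add]
      congr 2
      abel
    simp only [h2] at h1
    have h3 : ∀ ψ : AddChar Q ℂ, ψ (Submodule.Quotient.mk (-ε)) *
        ((b α : ℂ) * ψ (Submodule.Quotient.mk α)) =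
        (b α : ℂ) * (ψ (Submodule.Quotient.mk (-ε)) * ψ (Submodule.Quotient.mk α)) :=
      fun ψ => by ring
    simp_rw [h3]
    rw [← Finset.mul_sum, h1]
    split_ifs
    · exact (congrArg _ hcardm').trans (mul_comm _ _)
    · simp
  have hzero : characterPoint (0 : AddChar Q ℂ) = 1 := by
    ext j
    simp [characterPoint]
  -- The trivial character contributes the mass `symbol b 1`; there are at most `m` others, each
  -- bounded by the sum rule defect.
  rw [← Finset.add_sum_erase _ _ (Finset.mem_univ (0 : AddChar Q ℂ)), hzero,
    AddChar.zero_apply, one_mul] at hchar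
  have hrest : ‖∑ ψ ∈ Finset.univ.erase (0 : AddChar Q ℂ),
      ψ (Submodule.Quotient.mk (-ε)) * symbol b (characterPoint ψ)‖ ≤ m * sumRuleDefect M b := by
    refine (norm_sum_le_of_le _ (n := fun _ => sumRuleDefect M b) fun ψ hψ => ?_).trans ?_
    · rw [norm_mul, AddChar.norm_apply, one_mul]
      exact norm_symbol_le_sumRuleDefect hb (characterPoint_mem_dualPoints ψ hM)
        (characterPoint_ne_one ψ (Finset.ne_of_mem_erase hψ))
    · rw [Finset.sum_const, nsmul_eq_mul]
      refine mul_le_mul_of_nonneg_right ?_ sumRuleDefect_nonneg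
      rw [← hcardm, ← AddChar.card_eq (α := Q), ← Finset.card_univ]
      exact_mod_cast Finset.card_le_card (Finset.erase_subset _ _)
  have hmass : ‖symbol b 1 - (m : ℂ)‖ = massDefect M b := by
    rw [massDefect, hm, ← Int.cast_abs, Complex.ofReal_intCast]
  have htot : ‖(m : ℂ) * ((∑ x ∈ F, b (ε + M *ᵥ x) - 1 : ℝ) : ℂ)‖ ≤ sumRuleError M b := by
    have h : (m : ℂ) * ((∑ x ∈ F, b (ε + M *ᵥ x) - 1 : ℝ) : ℂ) = (symbol b 1 - (m : ℂ)) +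
        ∑ ψ ∈ Finset.univ.erase (0 : AddChar Q ℂ),
          ψ (Submodule.Quotient.mk (-ε)) * symbol b (characterPoint ψ) := by
      rw [Complex.ofReal_sub, mul_sub, ← hchar]
      push_cast
      ring
    rw [h]
    refine (norm_add_le _ _).trans ?_
    rw [hmass]
    exact add_le_add le_rfl hrest
  -- The factor `1 / m ≤ 1` available on the right is given away.
  rw [norm_mul, Complex.norm_real, Complex.norm_real, Real.norm_eq_abs, Real.norm_eq_abs,
    abs_of_nonneg (zero_le_one.trans hm1)] at htot
  exact (le_mul_of_one_le_left (abs_nonneg _) hm1).trans htot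

end SumRules

/-! ### Joint spectral radius -/

section Gauge

variable {V : Type*} [NormedAddCommGroup V] [NormedSpace ℝ V] {𝓣 : Set (V →L[ℝ] V)}

theorem norm_list_prod_le_pow {C : ℝ} (hC : ∀ T ∈ 𝓣, ‖T‖ ≤ C) (hC1 : 1 ≤ C)
    (L : List (V →L[ℝ] V)) (hL : ∀ T ∈ L, T ∈ 𝓣) : ‖L.prod‖ ≤ C ^ L.length := by
  induction L with
  | nil =>
    rw [List.prod_nil, List.length_nil, pow_zero]
    exact ContinuousLinearMap.norm_id_le
  | cons T L ih =>
    rw [List.prod_cons, List.length_cons, pow_succ']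
    exact (norm_mul_le _ _).trans (mul_le_mul (hC T (hL T (by simp)))
      (ih fun S hS => hL S (by simp [hS])) (norm_nonneg _) (zero_le_one.trans hC1))

/-- The spectral radius controls only products of length at least some `n₀`; boundedness of the set
takes care of the shorter ones. -/
theorem exists_norm_list_prod_le (hbdd : ∃ C, ∀ T ∈ 𝓣, ‖T‖ ≤ C)
    (hρ : jointSpectralRadius 𝓣 < 1) :
    ∃ q C : ℝ, 0 < q ∧ q < 1 ∧ 1 ≤ C ∧
      ∀ L : List (V →L[ℝ] V), (∀ T ∈ L, T ∈ 𝓣) → ‖L.prod‖ ≤ C * q ^ L.length := by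
  obtain ⟨q, hq, hq1⟩ := ENNReal.lt_iff_exists_nnreal_btwn.1 hρ
  have hq0 : 0 < q := by
    have := (zero_le).trans_lt hq
    exact_mod_cast this
  obtain ⟨n₀, hn₀⟩ := eventually_atTop.1
    ((eventually_lt_of_limsup_lt hq).and (eventually_gt_atTop 0))
  have hlong : ∀ L : List (V →L[ℝ] V), (∀ T ∈ L, T ∈ 𝓣) → n₀ ≤ L.length →
      ‖L.prod‖ ≤ (q : ℝ) ^ L.length := by
    intro L hL hn
    obtain ⟨h1, h0⟩ := hn₀ _ hn
    have h2 := (le_iSup (fun T : Fin L.length → 𝓣 =>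
      ‖(List.ofFn fun i => (T i : V →L[ℝ] V)).prod‖ₑ ^ (1 / (L.length : ℝ)))
      fun i => ⟨L.get i, hL _ (List.get_mem L i)⟩).trans h1.le
    simp only [List.ofFn_get] at h2
    have hn0 : (0 : ℝ) < L.length := by exact_mod_cast h0
    have h3 := ENNReal.rpow_le_rpow h2 hn0.le
    rw [← ENNReal.rpow_mul, one_div, inv_mul_cancel₀ hn0.ne', ENNReal.rpow_one,
      ENNReal.rpow_natCast] at h3
    exact_mod_cast h3
  obtain ⟨C, hC⟩ := hbdd
  have hqr : (0 : ℝ) < q := by exact_mod_cast hq0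
  have hqr1 : (q : ℝ) < 1 := by exact_mod_cast hq1
  -- For length `l ≤ n₀` the product is at most `max 1 C ^ n₀`, while `q ^ l / q ^ n₀ ≥ 1`.
  refine ⟨q, max 1 C ^ n₀ / (q : ℝ) ^ n₀, hqr, hqr1, ?_, fun L hL => ?_⟩
  · rw [one_le_div (pow_pos hqr _)]
    exact (pow_le_one₀ hqr.le hqr1.le).trans (one_le_pow₀ (le_max_left _ _))
  · rw [div_mul_eq_mul_div, le_div_iff₀ (pow_pos hqr _)]
    rcases le_total n₀ L.length with hn | hn
    · have h1 : (q : ℝ) ^ n₀ ≤ max 1 C ^ n₀ :=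
        (pow_le_one₀ hqr.le hqr1.le).trans (one_le_pow₀ (le_max_left _ _))
      rw [mul_comm]
      exact mul_le_mul h1 (hlong L hL hn) (norm_nonneg _) (by positivity)
    · have h1 := norm_list_prod_le_pow (fun T hT => (hC T hT).trans (le_max_right 1 C))
        (le_max_left _ _) L hL
      refine mul_le_mul (h1.trans (pow_le_pow_right₀ (le_max_left _ _) hn)) ?_ (by positivity)
        (by positivity)
      exact pow_le_pow_of_le_one hqr.le hqr1.le hn

/-- A bounded set of operators with joint spectral radius less than one contracts a common gauge
which is equivalent to the norm. -/
theorem exists_contracting_gauge (hbdd : ∃ C, ∀ T ∈ 𝓣, ‖T‖ ≤ C)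
    (hρ : jointSpectralRadius 𝓣 < 1) :
    ∃ (p : V → ℝ) (q C : ℝ), 0 < q ∧ q < 1 ∧ 1 ≤ C ∧ (∀ v, ‖v‖ ≤ p v) ∧ (∀ v, p v ≤ C * ‖v‖) ∧
      ∀ T ∈ 𝓣, ∀ v, p (T v) ≤ q * p v := by
  obtain ⟨q, C, hq0, hq1, hC1, hC⟩ := exists_norm_list_prod_le hbdd hρ
  have hle : ∀ (v : V) (L : {L : List (V →L[ℝ] V) // ∀ T ∈ L, T ∈ 𝓣}),
      ‖L.1.prod v‖ / q ^ L.1.length ≤ C * ‖v‖ := by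
    intro v L
    rw [div_le_iff₀ (pow_pos hq0 _)]
    calc ‖L.1.prod v‖ ≤ ‖L.1.prod‖ * ‖v‖ := ContinuousLinearMap.le_opNorm _ _
      _ ≤ C * q ^ L.1.length * ‖v‖ := mul_le_mul_of_nonneg_right (hC _ L.2) (norm_nonneg _)
      _ = C * ‖v‖ * q ^ L.1.length := by ring
  have hbdd' : ∀ v : V, BddAbove (Set.range fun L : {L : List (V →L[ℝ] V) // ∀ T ∈ L, T ∈ 𝓣} =>
      ‖L.1.prod v‖ / q ^ L.1.length) := by
    intro v
    refine ⟨C * ‖v‖, ?_⟩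
    rintro _ ⟨L, rfl⟩
    exact hle v L
  have : Nonempty {L : List (V →L[ℝ] V) // ∀ T ∈ L, T ∈ 𝓣} := ⟨⟨[], by simp⟩⟩
  -- The gauge is the supremum of `‖T₁ ⋯ T_l v‖ / q ^ l` over all words. The empty word gives `‖v‖ ≤
  -- p v`, and appending `T` to a word gives the contraction at the price of one factor `q`.
  refine ⟨fun v => ⨆ L : {L : List (V →L[ℝ] V) // ∀ T ∈ L, T ∈ 𝓣},
    ‖L.1.prod v‖ / q ^ L.1.length, q, C, hq0, hq1, hC1, fun v => ?_, fun v => ciSup_le (hle v),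
    fun T hT v => ciSup_le fun L => ?_⟩
  · simpa using le_ciSup (hbdd' v) ⟨[], by simp⟩
  · have h1 := le_ciSup (hbdd' v) ⟨L.1 ++ [T], by
      intro S hS
      rcases List.mem_append.1 hS with h | h
      · exact L.2 S h
      · rw [List.mem_singleton.1 h]; exact hT⟩
    simp only [List.prod_append, List.prod_singleton, List.length_append, List.length_singleton,
      mul_apply_eq_comp] at h1
    refine le_trans (le_of_eq ?_) (mul_le_mul_of_nonneg_left h1 hq0.le)
    rw [pow_succ]
    field_simp

end Gauge

/-! ### Limit masks -/

section LimitMasks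

variable {s : ℕ} {M : Matrix (Fin s) (Fin s) ℤ} {N : ℕ} {a : ℕ → (Fin s → ℤ) → ℝ}
  {b : (Fin s → ℤ) → ℝ}

theorem SupportedOnBox.mem_Icc (hb : SupportedOnBox N b) {α : Fin s → ℤ} (h : b α ≠ 0) :
    α ∈ Set.Icc (0 : Fin s → ℤ) fun _ => (N : ℤ) :=
  ⟨fun j => (hb α h j).1, fun j => (hb α h j).2⟩

theorem supportedOnBox_of_mem_limitPoints (hsupp : ∀ k, SupportedOnBox N (a k))
    (hb : b ∈ limitPoints a) : SupportedOnBox N b := by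
  obtain ⟨φ, -, hφ⟩ := hb
  intro α hα
  by_contra h
  refine hα (tendsto_nhds_unique ((tendsto_pi_nhds.1 hφ) α) ?_)
  have h0 : ∀ n, a (φ n) α = 0 := fun n => by_contra fun hne => h (hsupp _ α hne)
  simp [h0]

theorem abs_le_of_mem_limitPoints {B : ℝ} (hB : ∀ k α, |a k α| ≤ B) (hb : b ∈ limitPoints a)
    (α : Fin s → ℤ) : |b α| ≤ B := by
  obtain ⟨φ, -, hφ⟩ := hb
  exact le_of_tendsto' ((tendsto_pi_nhds.1 hφ) α).abs fun n => hB _ _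

theorem summable_sumRuleError (hsum : ApproxSumRulesOne M a) :
    Summable fun k => sumRuleError M (a k) :=
  hsum.1.add (hsum.2.mul_left _)

/-- Summable sum rule errors tend to zero along the subsequence. A single `F` serves all masks
because it is tied to the common support box. -/
theorem sum_coset_eq_one_of_mem_limitPoints (hM : IsExpanding M)
    (hsupp : ∀ k, SupportedOnBox N (a k)) (hsum : ApproxSumRulesOne M a)
    (hb : b ∈ limitPoints a) (ε : Fin s → ℤ) {F : Finset (Fin s → ℤ)}
    (hF : ∀ x, ε + M *ᵥ x ∈ Set.Icc (0 : Fin s → ℤ) (fun _ => (N : ℤ)) → x ∈ F) :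
    ∑ x ∈ F, b (ε + M *ᵥ x) = 1 := by
  obtain ⟨φ, hφ, hlim⟩ := hb
  have h1 : Tendsto (fun n => ∑ x ∈ F, a (φ n) (ε + M *ᵥ x)) atTop
      (𝓝 (∑ x ∈ F, b (ε + M *ᵥ x))) :=
    tendsto_finsetSum _ fun x _ => (tendsto_pi_nhds.1 hlim) _
  refine tendsto_nhds_unique h1 (tendsto_iff_norm_sub_tendsto_zero.2 ?_)
  refine squeeze_zero (fun _ => norm_nonneg _) (fun n => ?_)
    ((summable_sumRuleError hsum).tendsto_atTop_zero.comp hφ.tendsto_atTop)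
  exact abs_sum_coset_sub_one_le hM (hsupp _) ε fun x hx => hF x ((hsupp _).mem_Icc hx)

/-- The masks approach the set of their limit points. -/
theorem eventually_exists_mem_limitPoints_abs_sub_le (hsupp : ∀ k, SupportedOnBox N (a k))
    (hbdd : ∃ B : ℝ, ∀ k α, |a k α| ≤ B) {δ : ℝ} (hδ : 0 < δ) :
    ∀ᶠ k in atTop, ∃ b ∈ limitPoints a, ∀ α, |a k α - b α| ≤ δ := by
  by_contra hcon
  obtain ⟨B, hB⟩ := hbdd
  -- Infinitely many masks far from all limit points would have a convergent subsequence by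
  -- compactness of `[-B, B]^{ℤ^s}`; on the finite box pointwise convergence is uniform, a
  -- contradiction.
  obtain ⟨φ, hφ, hfar⟩ := extraction_of_frequently_atTop (not_eventually.1 hcon)
  have hcomp : IsCompact (Set.univ.pi fun _ : Fin s → ℤ => Set.Icc (-B) B) :=
    isCompact_univ_pi fun _ => isCompact_Icc
  obtain ⟨b, -, ψ, hψ, hlim⟩ := hcomp.tendsto_subseq (x := fun n => a (φ n))
    fun n α _ => abs_le.1 (hB _ _)
  have hbL : b ∈ limitPoints a := ⟨φ ∘ ψ, hφ.comp hψ, hlim⟩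
  have hbs := supportedOnBox_of_mem_limitPoints hsupp hbL
  have hev : ∀ᶠ n in atTop, ∀ α ∈ Finset.Icc (0 : Fin s → ℤ) (fun _ => (N : ℤ)),
      |a (φ (ψ n)) α - b α| ≤ δ := by
    rw [eventually_all_finset]
    intro α _
    have h1 := (tendsto_iff_norm_sub_tendsto_zero.1 ((tendsto_pi_nhds.1 hlim) α))
    exact (h1.eventually_lt_const hδ).mono fun n hn => le_of_lt hn
  obtain ⟨n, hn⟩ := hev.exists
  refine hfar (ψ n) ⟨b, hbL, fun α => ?_⟩
  by_cases hα : α ∈ Finset.Icc (0 : Fin s → ℤ) (fun _ => (N : ℤ))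
  · exact hn α hα
  · have h1 : a (φ (ψ n)) α = 0 :=
      by_contra fun h => hα (Finset.mem_Icc.2 ((hsupp _).mem_Icc h))
    have h2 : b α = 0 := by_contra fun h => hα (Finset.mem_Icc.2 (hbs.mem_Icc h))
    rw [h1, h2, sub_zero, abs_zero]
    exact hδ.le

end LimitMasks

section Step

/-! ### Recursive inequalities -/

/-- The combination `x + L y` with `A + L q = L` absorbs the term `A y` and grows at most by factors
`1 + D η_k`, whose product converges. Once `x` is bounded, summing the second inequality bounds `∑
y`. -/
theorem exists_bound_of_recursive_le {x y η : ℕ → ℝ} {q A : ℝ} (hq : q < 1) (hA : 0 ≤ A)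
    (hx : ∀ k, 0 ≤ x k) (hy : ∀ k, 0 ≤ y k) (hη : ∀ k, 0 ≤ η k) (hsum : Summable η)
    (hxs : ∀ k, x (k + 1) ≤ (1 + A * η k) * x k + A * y k)
    (hys : ∀ k, y (k + 1) ≤ q * y k + A * η k * x k) :
    (∃ X, ∀ k, x k ≤ X) ∧ Summable y := by
  set L : ℝ := A / (1 - q) with hL
  have hq' : 0 < 1 - q := sub_pos.2 hq
  have hL0 : 0 ≤ L := div_nonneg hA hq'.le
  have hLA : A + L * q = L := by rw [hL]; field_simp; ring
  set D : ℝ := A * (1 + L) with hD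
  have hD0 : 0 ≤ D := mul_nonneg hA (by linarith)
  have hΦ : ∀ k, x k + L * y k ≤
      (x 0 + L * y 0) * Real.exp (∑ i ∈ Finset.range k, D * η i) := by
    intro k
    induction k with
    | zero => simp
    | succ k ih =>
      have h0 : 0 ≤ x k + L * y k := add_nonneg (hx k) (mul_nonneg hL0 (hy k))
      have h1 : x (k + 1) + L * y (k + 1) ≤ (1 + D * η k) * (x k + L * y k) := by
        have h2 := mul_le_mul_of_nonneg_left (hys k) hL0
        have h3 : 0 ≤ D * η k * (L * y k) :=
          mul_nonneg (mul_nonneg hD0 (hη k)) (mul_nonneg hL0 (hy k))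
        calc x (k + 1) + L * y (k + 1)
            ≤ ((1 + A * η k) * x k + A * y k) + L * (q * y k + A * η k * x k) :=
              add_le_add (hxs k) h2
          _ = (1 + D * η k) * x k + (A + L * q) * y k := by rw [hD]; ring
          _ ≤ (1 + D * η k) * (x k + L * y k) := by rw [hLA]; linarith
      rw [Finset.sum_range_succ, Real.exp_add, ← mul_assoc]
      calc x (k + 1) + L * y (k + 1) ≤ (1 + D * η k) * (x k + L * y k) := h1
        _ ≤ Real.exp (D * η k) * (x k + L * y k) := by
          refine mul_le_mul_of_nonneg_right ?_ h0
          rw [add_comm]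
          exact Real.add_one_le_exp _
        _ = (x k + L * y k) * Real.exp (D * η k) := mul_comm _ _
        _ ≤ _ := mul_le_mul_of_nonneg_right ih (Real.exp_pos _).le
  have hX : ∀ k, x k ≤ (x 0 + L * y 0) * Real.exp (∑' i, D * η i) := by
    intro k
    have h1 := hΦ k
    have h2 : ∑ i ∈ Finset.range k, D * η i ≤ ∑' i, D * η i :=
      Summable.sum_le_tsum _ (fun i _ => mul_nonneg hD0 (hη i)) (hsum.mul_left D)
    have h3 : 0 ≤ x 0 + L * y 0 := add_nonneg (hx 0) (mul_nonneg hL0 (hy 0))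
    have h4 := mul_le_mul_of_nonneg_left (Real.exp_le_exp.2 h2) h3
    have h5 := mul_nonneg hL0 (hy k)
    linarith
  refine ⟨⟨_, hX⟩, ?_⟩
  set X := (x 0 + L * y 0) * Real.exp (∑' i, D * η i) with hXdef
  have hX0 : 0 ≤ X := (hx 0).trans (hX 0)
  -- Summation gives `(1 - q) ∑ y ≤ y 0 + A X ∑ η`.
  refine summable_of_sum_range_le (c := (y 0 + A * X * ∑' i, η i) / (1 - q)) hy fun n => ?_
  rw [le_div_iff₀ hq']
  have hn : ∑ k ∈ Finset.range n, y (k + 1) ≤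
      ∑ k ∈ Finset.range n, (q * y k + A * X * η k) := by
    refine Finset.sum_le_sum fun k _ => (hys k).trans ?_
    have := mul_le_mul_of_nonneg_left (hX k) (mul_nonneg hA (hη k))
    linarith
  rw [Finset.sum_add_distrib, ← Finset.mul_sum, ← Finset.mul_sum] at hn
  have h1 : ∑ k ∈ Finset.range n, η k ≤ ∑' i, η i :=
    Summable.sum_le_tsum _ (fun i _ => hη i) hsum
  have h2 := mul_le_mul_of_nonneg_left h1 (mul_nonneg hA hX0)
  have h3 := Finset.sum_range_succ' y n
  rw [Finset.sum_range_succ] at h3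
  have h4 := hy n
  linarith

/-! ### One subdivision step -/

variable {s : ℕ} {M : Matrix (Fin s) (Fin s) ℤ} {N : ℕ} {b c : (Fin s → ℤ) → ℝ}

/-- After the reflection of the summation index at `γ` the coefficients no longer depend on `γ`:
they are entries of a transition matrix. -/
theorem subdivision_apply_eq_sum {γ ε β : Fin s → ℤ} {S : Finset (Fin s → ℤ)}
    (hS : ∀ x, b (ε + M *ᵥ x - β) ≠ 0 → x ∈ S) :
    subdivision M b c (M *ᵥ γ + ε - β) = ∑ x ∈ S, b (ε + M *ᵥ x - β) * c (γ - x) := by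
  rw [subdivision, ← finsum_comp_equiv (Equiv.subLeft γ)]
  have h : ∀ x, M *ᵥ γ + ε - β - M *ᵥ (Equiv.subLeft γ x) = ε + M *ᵥ x - β := by
    intro x
    rw [Equiv.subLeft_apply, Matrix.mulVec_sub]
    abel
  simp_rw [h, Equiv.subLeft_apply]
  refine finsum_eq_sum_of_support_subset _ fun x hx => hS x fun h0 => ?_
  simp [h0] at hx

/-- The new values are close to the old ones up to the oscillation of the old values and the
sum rule error. -/
theorem abs_subdivision_sub_le (hM : IsExpanding M) (hb : SupportedOnBox N b) {B D X : ℝ}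
    (hB : ∀ α, |b α| ≤ B) (hX : ∀ α, |c α| ≤ X) {γ ε β x₀ : Fin s → ℤ}
    {S : Finset (Fin s → ℤ)}
    (hS : ∀ x, ε + M *ᵥ x - β ∈ Set.Icc (0 : Fin s → ℤ) (fun _ => (N : ℤ)) → x ∈ S)
    (hD : ∀ x ∈ S, |c (γ - x) - c (γ - x₀)| ≤ D) :
    |subdivision M b c (M *ᵥ γ + ε - β) - c (γ - x₀)| ≤
      S.card * (B * D) + sumRuleError M b * X := by
  rw [subdivision_apply_eq_sum fun x hx => hS x (hb.mem_Icc hx)]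
  have hsum := abs_sum_coset_sub_one_le hM hb (ε - β) (F := S) fun x hx =>
    hS x (by
      have := hb.mem_Icc hx
      rwa [show ε - β + M *ᵥ x = ε + M *ᵥ x - β by abel] at this)
  simp_rw [show ∀ x, ε - β + M *ᵥ x = ε + M *ᵥ x - β from fun x => by abel] at hsum
  have h1 : ∑ x ∈ S, b (ε + M *ᵥ x - β) * c (γ - x) - c (γ - x₀) =
      ∑ x ∈ S, b (ε + M *ᵥ x - β) * (c (γ - x) - c (γ - x₀)) +
        (∑ x ∈ S, b (ε + M *ᵥ x - β) - 1) * c (γ - x₀) := by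
    simp_rw [mul_sub, Finset.sum_sub_distrib, ← Finset.sum_mul]
    ring
  rw [h1]
  refine (abs_add_le _ _).trans (add_le_add ?_ ?_)
  · rw [← nsmul_eq_mul]
    refine (Finset.abs_sum_le_sum_abs _ _).trans (Finset.sum_le_card_nsmul _ _ _ fun x hx => ?_)
    rw [abs_mul]
    exact mul_le_mul (hB _) (hD x hx) (abs_nonneg _) ((abs_nonneg _).trans (hB 0))
  · rw [abs_mul]
    exact mul_le_mul hsum (hX _) (abs_nonneg _) sumRuleError_nonneg

theorem isBoundedSeq_subdivision (hM : IsExpanding M) (hb : SupportedOnBox N b)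
    (hB : ∃ B : ℝ, ∀ α, |b α| ≤ B) (hc : IsBoundedSeq c) : IsBoundedSeq (subdivision M b c) := by
  obtain ⟨B, hB⟩ := hB
  obtain ⟨X, hX⟩ := hc
  have hfin : (Set.Icc (0 : Fin s → ℤ) fun _ => (N : ℤ)).Finite := Set.finite_Icc _ _
  set n := (Finset.Icc (0 : Fin s → ℤ) fun _ => (N : ℤ)).card with hn
  refine ⟨n * (B * X), fun α => ?_⟩
  have hpre : ((fun x => α + M *ᵥ x) ⁻¹' Set.Icc (0 : Fin s → ℤ) fun _ => (N : ℤ)).Finite :=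
    hfin.preimage (fun x _ y _ h => hM.mulVec_injective (add_left_cancel h))
  have h1 := subdivision_apply_eq_sum (M := M) (b := b) (c := c) (γ := 0) (ε := α) (β := 0)
    (S := hpre.toFinset) fun x hx => by simpa using hb.mem_Icc hx
  rw [Matrix.mulVec_zero, zero_add, sub_zero] at h1
  rw [h1]
  have hB0 : 0 ≤ B := (abs_nonneg _).trans (hB 0)
  have hX0 : 0 ≤ X := (abs_nonneg _).trans (hX 0)
  refine (Finset.abs_sum_le_sum_abs _ _).trans
    ((Finset.sum_le_card_nsmul _ _ (B * X) fun x hx => ?_).trans ?_)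
  · rw [abs_mul]
    exact mul_le_mul (hB _) (hX _) (abs_nonneg _) hB0
  · rw [nsmul_eq_mul]
    refine mul_le_mul_of_nonneg_right ?_ (mul_nonneg hB0 hX0)
    have : hpre.toFinset.card ≤ n :=
      Finset.card_le_card_of_injOn (fun x => α + M *ᵥ x)
        (fun x hx => by simpa using hx)
        (fun x _ y _ h => hM.mulVec_injective (add_left_cancel h))
    exact_mod_cast this

theorem isBoundedSeq_subdivisionIter (hM : IsExpanding M) {a : ℕ → (Fin s → ℤ) → ℝ}
    (hsupp : ∀ k, SupportedOnBox N (a k)) (hbdd : ∃ B : ℝ, ∀ k α, |a k α| ≤ B)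
    (hc : IsBoundedSeq c) (k : ℕ) : IsBoundedSeq (subdivisionIter M a c k) := by
  induction k with
  | zero => exact hc
  | succ k ih =>
    exact isBoundedSeq_subdivision hM (hsupp k) (hbdd.imp fun B hB => hB k) ih

end Step

/-! ### Transition matrices on the zero-sum subspace -/

section Transition

variable {s : ℕ} {M : Matrix (Fin s) (Fin s) ℤ} {N : ℕ} {K E : Finset (Fin s → ℤ)}
  {b c : (Fin s → ℤ) → ℝ}

theorem transitionMatrix_mulVec_apply (ε : Fin s → ℤ) (v : K → ℝ) (x : K) :
    (transitionMatrix M K b ε *ᵥ v) x = ∑ β : K, b (ε + M *ᵥ (x : Fin s → ℤ) - β) * v β := rfl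

theorem abs_transitionMatrix_mulVec_le {B : ℝ} (hB : ∀ α, |b α| ≤ B) (ε : Fin s → ℤ)
    (v : K → ℝ) (x : K) : |(transitionMatrix M K b ε *ᵥ v) x| ≤ K.card * (B * ‖v‖) := by
  rw [transitionMatrix_mulVec_apply]
  refine (Finset.abs_sum_le_sum_abs _ _).trans
    ((Finset.sum_le_card_nsmul _ _ (B * ‖v‖) fun β _ => ?_).trans ?_)
  · rw [abs_mul]
    exact mul_le_mul (hB _) (norm_le_pi_norm v β) (abs_nonneg _) ((abs_nonneg _).trans (hB 0))
  · rw [nsmul_eq_mul, Finset.card_univ, Fintype.card_coe]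

theorem mem_zeroSumSubspace {v : K → ℝ} : v ∈ zeroSumSubspace K ↔ ∑ x, v x = 0 := Iff.rfl

/-- The column sums of a transition matrix are coset sums of the mask, so the sum rules decide
whether the zero-sum subspace is preserved. -/
theorem sum_transitionMatrix_mulVec (ε : Fin s → ℤ) (v : K → ℝ) :
    ∑ x, (transitionMatrix M K b ε *ᵥ v) x =
      ∑ β : K, (∑ x ∈ K, b (ε + M *ᵥ x - β)) * v β := by
  simp_rw [transitionMatrix_mulVec_apply]
  rw [Finset.sum_comm]
  refine Finset.sum_congr rfl fun β _ => ?_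
  rw [← Finset.sum_coe_sort K fun x => b (ε + M *ᵥ x - β), Finset.sum_mul]

/-- Subdivision acts on the values in `γ - K` by the transposed transition matrices. -/
theorem sum_mul_subdivision {ε γ : Fin s → ℤ}
    (hK : ∀ β ∈ K, ∀ x, b (ε + M *ᵥ x - β) ≠ 0 → x ∈ K) (v : K → ℝ) :
    ∑ β : K, v β * subdivision M b c (M *ᵥ γ + ε - β) =
      ∑ x : K, (transitionMatrix M K b ε *ᵥ v) x * c (γ - x) := by
  simp_rw [transitionMatrix_mulVec_apply, Finset.sum_mul]
  rw [Finset.sum_comm]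
  refine Finset.sum_congr rfl fun β _ => ?_
  rw [subdivision_apply_eq_sum (hK β β.2), ← Finset.sum_coe_sort K, Finset.mul_sum]
  exact Finset.sum_congr rfl fun x _ => by ring

theorem norm_le_of_mem_restrictedTransitions {A : Set ((Fin s → ℤ) → ℝ)} {B : ℝ} (hB0 : 0 ≤ B)
    (hB : ∀ b ∈ A, ∀ α, |b α| ≤ B) {T : zeroSumSubspace K →L[ℝ] zeroSumSubspace K}
    (hT : T ∈ restrictedTransitions M K E A) : ‖T‖ ≤ K.card * B := by
  obtain ⟨b, hb, ε, -, hT⟩ := hT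
  refine T.opNorm_le_bound (by positivity) fun v => ?_
  rw [Submodule.coe_norm, hT v, pi_norm_le_iff_of_nonneg (by positivity)]
  intro x
  rw [mul_assoc]
  exact abs_transitionMatrix_mulVec_le (hB b hb) ε v x

/-- `restrictedTransitions` contains only operators that map the zero-sum subspace to itself; unit
column sums ensure that the one for `b` and `ε` exists. -/
theorem exists_mem_restrictedTransitions {A : Set ((Fin s → ℤ) → ℝ)} (hb : b ∈ A)
    {ε : Fin s → ℤ} (hε : ε ∈ E) (h1 : ∀ β ∈ K, ∑ x ∈ K, b (ε + M *ᵥ x - β) = 1) :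
    ∃ T ∈ restrictedTransitions M K E A, ∀ v : zeroSumSubspace K,
      ((T v : zeroSumSubspace K) : K → ℝ) = transitionMatrix M K b ε *ᵥ (v : K → ℝ) := by
  have hmaps : ∀ v ∈ zeroSumSubspace K,
      (transitionMatrix M K b ε).mulVecLin v ∈ zeroSumSubspace K := by
    intro v hv
    rw [mem_zeroSumSubspace] at hv ⊢
    rw [Matrix.mulVecLin_apply, sum_transitionMatrix_mulVec, ← hv]
    exact Finset.sum_congr rfl fun β _ => by rw [h1 β β.2, one_mul]
  let T := ((transitionMatrix M K b ε).mulVecLin.restrict hmaps).toContinuousLinearMap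
  have hT : ∀ v : zeroSumSubspace K,
      ((T v : zeroSumSubspace K) : K → ℝ) = transitionMatrix M K b ε *ᵥ (v : K → ℝ) := by
    intro v
    rfl
  exact ⟨T, ⟨b, hb, ε, hε, hT⟩, hT⟩

/-- The contraction of the zero-sum functionals of the values in `γ - K` in one subdivision step
with a mask that is close to a mask with a contracting transition matrix. -/
theorem abs_sum_mul_subdivision_le (hM : IsExpanding M) (hb : SupportedOnBox N b)
    {p : zeroSumSubspace K → ℝ} {q C δ X d : ℝ} (hC1 : 1 ≤ C)
    (hp : ∀ v, ‖v‖ ≤ p v) (hpC : ∀ v, p v ≤ C * ‖v‖) (hδ : 0 ≤ δ)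
    (hX : ∀ α, |c α| ≤ X) (hd : 0 ≤ d)
    (hcd : ∀ γ, ∀ v : zeroSumSubspace K,
      |∑ x : K, (v : K → ℝ) x * c (γ - x)| ≤ d * p v)
    {ε γ : Fin s → ℤ}
    (hK : ∀ β ∈ K, ∀ x, ε + M *ᵥ x - β ∈ Set.Icc (0 : Fin s → ℤ) (fun _ => (N : ℤ)) → x ∈ K)
    {b₀ : (Fin s → ℤ) → ℝ} (hbb₀ : ∀ α, |b α - b₀ α| ≤ δ)
    {T : zeroSumSubspace K →L[ℝ] zeroSumSubspace K}
    (hT : ∀ v : zeroSumSubspace K,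
      ((T v : zeroSumSubspace K) : K → ℝ) = transitionMatrix M K b₀ ε *ᵥ (v : K → ℝ))
    (hTp : ∀ v, p (T v) ≤ q * p v) (v : zeroSumSubspace K) :
    |∑ β : K, (v : K → ℝ) β * subdivision M b c (M *ᵥ γ + ε - β)| ≤
      ((q + 2 * C * K.card ^ 2 * δ) * d + K.card * sumRuleError M b * X) * p v := by
  classical
  rw [sum_mul_subdivision fun β hβ x hx => hK β hβ x (hb.mem_Icc hx)]
  set n : ℝ := (K.card : ℝ) with hn
  have hn0 : 0 ≤ n := Nat.cast_nonneg _
  have hX0 : 0 ≤ X := (abs_nonneg _).trans (hX 0)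
  have hpv : 0 ≤ p v := (norm_nonneg v).trans (hp v)
  -- With `K` empty only `q * p v ≥ 0` is needed. No sign of `q` is given, so it comes from `0 ≤ p
  -- (T v) ≤ q * p v`.
  rcases K.eq_empty_or_nonempty with hKe | ⟨x₀, hx₀⟩
  · have : IsEmpty K := by subst hKe; infer_instance
    rw [Finset.univ_eq_empty, Finset.sum_empty, abs_zero]
    have h1 := hTp v
    have h2 : K.card = 0 := by rw [hKe]; rfl
    have h3 : 0 ≤ q * p v := ((norm_nonneg _).trans (hp (T v))).trans h1
    have h4 : n = 0 := by rw [hn, h2, Nat.cast_zero]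
    rw [h4]
    exact (mul_nonneg hd h3).trans (le_of_eq (by ring))
  have hn1 : 1 ≤ n := by
    rw [hn]
    exact_mod_cast Finset.card_pos.2 ⟨x₀, hx₀⟩
  set w : K → ℝ := (v : K → ℝ) with hw
  -- The perturbation `u` is of order `δ` but may leave the zero-sum subspace. Its total `σ` is
  -- estimated twice: by the sum rule error for the term multiplied by the data, and by `δ` for the
  -- norm of the corrected vector.
  set u : K → ℝ := transitionMatrix M K b ε *ᵥ w - transitionMatrix M K b₀ ε *ᵥ w with hu
  set σ : ℝ := ∑ x, u x with hσ
  have hTv0 : ∑ x, (transitionMatrix M K b₀ ε *ᵥ w) x = 0 := by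
    rw [← hT v]
    exact (T v).2
  have hu_le : ∀ x, |u x| ≤ n * (δ * ‖w‖) := by
    intro x
    have h1 : u x = (transitionMatrix M K (fun α => b α - b₀ α) ε *ᵥ w) x := by
      simp only [hu, Pi.sub_apply, transitionMatrix_mulVec_apply, ← Finset.sum_sub_distrib,
        sub_mul]
    rw [h1]
    exact abs_transitionMatrix_mulVec_le hbb₀ ε w x
  have hwp : ‖w‖ ≤ p v := hp v
  have hσ1 : |σ| ≤ n * (sumRuleError M b * ‖w‖) := by
    have h1 : σ = ∑ β : K, (∑ x ∈ K, b (ε + M *ᵥ x - β) - 1) * w β := by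
      rw [hσ, hu]
      simp only [Pi.sub_apply, Finset.sum_sub_distrib, sub_mul, one_mul]
      rw [hTv0, sum_transitionMatrix_mulVec, mem_zeroSumSubspace.1 v.2]
    rw [h1]
    refine (Finset.abs_sum_le_sum_abs _ _).trans
      ((Finset.sum_le_card_nsmul _ _ (sumRuleError M b * ‖w‖) fun β _ => ?_).trans ?_)
    · rw [abs_mul]
      refine mul_le_mul ?_ (norm_le_pi_norm w β) (abs_nonneg _) sumRuleError_nonneg
      have h2 : ∀ x, ε + M *ᵥ x - (β : Fin s → ℤ) = ε - β + M *ᵥ x := fun x => by abel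
      simp_rw [h2]
      refine abs_sum_coset_sub_one_le hM hb _ fun x hx => hK β β.2 x ?_
      rw [h2]
      exact hb.mem_Icc hx
    · rw [nsmul_eq_mul, Finset.card_univ, Fintype.card_coe]
  have hσ2 : |σ| ≤ n * (n * (δ * ‖w‖)) := by
    refine (Finset.abs_sum_le_sum_abs _ _).trans
      ((Finset.sum_le_card_nsmul _ _ _ fun x _ => hu_le x).trans ?_)
    rw [nsmul_eq_mul, Finset.card_univ, Fintype.card_coe]
  -- Removing the mass `σ` at `x₀` puts `u` back into the zero-sum subspace, where `hcd` applies;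
  -- what remains is `σ * c (γ - x₀)`.
  set e : K → ℝ := Pi.single ⟨x₀, hx₀⟩ 1 with he
  have hez : u - σ • e ∈ zeroSumSubspace K := by
    rw [mem_zeroSumSubspace]
    have h1 : ∑ x, (σ • e) x = σ := by simp [he, Pi.single_apply]
    simp only [Pi.sub_apply, Finset.sum_sub_distrib]
    rw [h1, ← hσ, sub_self]
  set z : zeroSumSubspace K := ⟨u - σ • e, hez⟩ with hz
  have hznorm : ‖z‖ ≤ 2 * n ^ 2 * δ * ‖w‖ := by
    rw [Submodule.coe_norm]
    have h1 : ‖u‖ ≤ n * (δ * ‖w‖) :=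
      (pi_norm_le_iff_of_nonneg (by positivity)).2 fun x => hu_le x
    have h2 : ‖σ • e‖ ≤ n * (n * (δ * ‖w‖)) := by
      rw [norm_smul, he, Pi.norm_single, norm_one, mul_one]
      exact hσ2
    have h3 : n * (δ * ‖w‖) ≤ n * (n * (δ * ‖w‖)) :=
      mul_le_mul_of_nonneg_left (le_mul_of_one_le_left (by positivity) hn1) hn0
    calc ‖u - σ • e‖ ≤ ‖u‖ + ‖σ • e‖ := norm_sub_le _ _
      _ ≤ n * (n * (δ * ‖w‖)) + n * (n * (δ * ‖w‖)) := add_le_add (h1.trans h3) h2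
      _ = 2 * n ^ 2 * δ * ‖w‖ := by ring
  have hdecomp : ∑ x : K, (transitionMatrix M K b ε *ᵥ w) x * c (γ - x) =
      (∑ x : K, (T v : K → ℝ) x * c (γ - x) + ∑ x : K, (z : K → ℝ) x * c (γ - x)) +
        σ * c (γ - x₀) := by
    have h1 : σ * c (γ - x₀) = ∑ x : K, (σ • e) x * c (γ - x) := by
      simp [he, Pi.single_apply]
    rw [h1, ← Finset.sum_add_distrib, ← Finset.sum_add_distrib]
    refine Finset.sum_congr rfl fun x _ => ?_
    rw [hT v]
    simp only [hz, hu, Pi.sub_apply]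
    ring
  rw [hdecomp]
  have k1 : |∑ x : K, (T v : K → ℝ) x * c (γ - x)| ≤ d * (q * p v) :=
    (hcd γ (T v)).trans (mul_le_mul_of_nonneg_left (hTp v) hd)
  have k2 : |∑ x : K, (z : K → ℝ) x * c (γ - x)| ≤ d * (C * (2 * n ^ 2 * δ * p v)) := by
    refine (hcd γ z).trans (mul_le_mul_of_nonneg_left ((hpC z).trans ?_) hd)
    refine mul_le_mul_of_nonneg_left (hznorm.trans ?_) (zero_le_one.trans hC1)
    exact mul_le_mul_of_nonneg_left hwp (by positivity)
  have k3 : |σ * c (γ - x₀)| ≤ n * (sumRuleError M b * p v) * X := by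
    rw [abs_mul]
    refine mul_le_mul (hσ1.trans ?_) (hX _) (abs_nonneg _) ?_
    · exact mul_le_mul_of_nonneg_left
        (mul_le_mul_of_nonneg_left hwp sumRuleError_nonneg) hn0
    · exact mul_nonneg hn0 (mul_nonneg sumRuleError_nonneg hpv)
  calc _ ≤ d * (q * p v) + d * (C * (2 * n ^ 2 * δ * p v)) +
        n * (sumRuleError M b * p v) * X :=
      (abs_add_le _ _).trans (add_le_add ((abs_add_le _ _).trans (add_le_add k1 k2)) k3)
    _ = _ := by ring

end Transition

/-! ### Decay of the oscillation -/

section Oscillation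

variable {s : ℕ} {M : Matrix (Fin s) (Fin s) ℤ} {N : ℕ} {E : Finset (Fin s → ℤ)}
  {a : ℕ → (Fin s → ℤ) → ℝ}

theorem mem_indexSet_of_mem_Icc (hM : IsExpanding M) {ε x β : Fin s → ℤ} (hε : ε ∈ E)
    (hβ : β ∈ indexSet hM N E)
    (hx : ε + M *ᵥ x - β ∈ Set.Icc (0 : Fin s → ℤ) fun _ => (N : ℤ)) : x ∈ indexSet hM N E :=
  sourceSet_indexSet_subset hM ⟨ε, hε, β, hβ, hx⟩

/-- A bound for the zero-sum functionals of the values in `γ - K` bounds their oscillation. -/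
theorem abs_sub_le_of_zeroSum_bound {K : Finset (Fin s → ℤ)} {c : (Fin s → ℤ) → ℝ}
    {p : zeroSumSubspace K → ℝ} {C d : ℝ} (hC : 0 ≤ C) (hpC : ∀ v, p v ≤ C * ‖v‖) (hd : 0 ≤ d)
    {γ : Fin s → ℤ}
    (hcd : ∀ v : zeroSumSubspace K, |∑ x : K, (v : K → ℝ) x * c (γ - x)| ≤ d * p v)
    {x y : Fin s → ℤ} (hx : x ∈ K) (hy : y ∈ K) :
    |c (γ - x) - c (γ - y)| ≤ 2 * C * d := by
  classical
  set e : K → ℝ := Pi.single ⟨x, hx⟩ 1 - Pi.single ⟨y, hy⟩ 1 with he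
  have hez : e ∈ zeroSumSubspace K := by
    rw [mem_zeroSumSubspace]
    simp [he, Finset.sum_sub_distrib, Pi.single_apply]
  have h1 := hcd ⟨e, hez⟩
  have h2 : ∑ z : K, e z * c (γ - z) = c (γ - x) - c (γ - y) := by
    simp [he, sub_mul, Finset.sum_sub_distrib, Pi.single_apply]
  have h3 : ‖(⟨e, hez⟩ : zeroSumSubspace K)‖ ≤ 2 := by
    refine (norm_sub_le (Pi.single ⟨x, hx⟩ 1 : K → ℝ) (Pi.single ⟨y, hy⟩ 1)).trans (le_of_eq ?_)
    rw [Pi.norm_single, Pi.norm_single, norm_one]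
    norm_num
  rw [h2] at h1
  refine h1.trans ((mul_le_mul_of_nonneg_left ((hpC _).trans
    (mul_le_mul_of_nonneg_left h3 hC)) hd).trans (le_of_eq (by ring)))

/-- Size and oscillation must be estimated together: the oscillation feeds on the size through the
sum rule errors, and the size grows with the oscillation. -/
theorem eventually_abs_le_and_summable_oscillation_indexSet (hM : IsExpanding M)
    (hE : IsCosetReps M E) (hsupp : ∀ k, SupportedOnBox N (a k))
    (hbdd : ∃ B : ℝ, ∀ k α, |a k α| ≤ B) (hsum : ApproxSumRulesOne M a)
    (hρ : jointSpectralRadius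
      (restrictedTransitions M (indexSet hM N E) E (limitPoints a)) < 1)
    {c : (Fin s → ℤ) → ℝ} (hc : IsBoundedSeq c) :
    (∃ X, ∀ᶠ k in atTop, ∀ α, |subdivisionIter M a c k α| ≤ X) ∧
      ∃ d : ℕ → ℝ, Summable d ∧ ∀ᶠ k in atTop, ∀ γ, ∀ x ∈ indexSet hM N E,
        ∀ y ∈ indexSet hM N E,
          |subdivisionIter M a c k (γ - x) - subdivisionIter M a c k (γ - y)| ≤ d k := by
  obtain ⟨B, hB⟩ := hbdd
  have hB0 : 0 ≤ B := (abs_nonneg _).trans (hB 0 0)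
  set K := indexSet hM N E with hK
  obtain ⟨x₀, hx₀⟩ : K.Nonempty := nonempty_indexSet hM hE
  obtain ⟨p, q, C, hq0, hq1, hC1, hp, hpC, hTp⟩ := exists_contracting_gauge
    ⟨K.card * B, fun T hT => norm_le_of_mem_restrictedTransitions hB0
      (fun b hb => abs_le_of_mem_limitPoints hB hb) hT⟩ hρ
  have hC0 : 0 ≤ C := zero_le_one.trans hC1
  set n : ℝ := (K.card : ℝ) with hn
  have hn1 : 1 ≤ n := by
    rw [hn]
    exact_mod_cast Finset.card_pos.2 ⟨x₀, hx₀⟩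
  have hn0 : 0 ≤ n := zero_le_one.trans hn1
  -- Half of the gap `1 - q` is spent on replacing a mask by a nearby limit mask.
  set δ : ℝ := (1 - q) / (2 * (2 * C * n ^ 2)) with hδ
  have hδ0 : 0 < δ := div_pos (sub_pos.2 hq1) (by positivity)
  have hδq : q + 2 * C * n ^ 2 * δ = (1 + q) / 2 := by
    rw [hδ]
    have : 2 * C * n ^ 2 ≠ 0 := by positivity
    field_simp
    ring
  obtain ⟨k₀, hk₀⟩ := eventually_atTop.1
    (eventually_exists_mem_limitPoints_abs_sub_le hsupp ⟨B, hB⟩ hδ0)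
  set η : ℕ → ℝ := fun k => sumRuleError M (a (k₀ + k)) with hη
  have hη0 : ∀ k, 0 ≤ η k := fun k => sumRuleError_nonneg
  have hηs : Summable η := by
    have := (summable_nat_add_iff k₀).2 (summable_sumRuleError hsum)
    simpa only [hη, add_comm k₀] using this
  -- Here `x` bounds the data and `y` their zero-sum functionals measured by `p`. Levels start at
  -- `k₀`, from which on the masks are `δ`-close to limit masks.
  set P : ℕ → ℝ → ℝ → Prop := fun k x y =>
    (∀ α, |subdivisionIter M a c (k₀ + k) α| ≤ x) ∧ ∀ γ, ∀ v : zeroSumSubspace K,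
      |∑ z : K, (v : K → ℝ) z * subdivisionIter M a c (k₀ + k) (γ - z)| ≤ y * p v with hP
  set A : ℝ := n + n * (B * (2 * C)) with hA
  have hnA : n ≤ A := le_add_of_nonneg_right (by positivity)
  have hBA : n * (B * (2 * C)) ≤ A := le_add_of_nonneg_left hn0
  have hA0 : 0 ≤ A := hn0.trans hnA
  have hstep : ∀ k x y, 0 ≤ x → 0 ≤ y → P k x y →
      P (k + 1) ((1 + A * η k) * x + A * y) ((1 + q) / 2 * y + A * η k * x) := by
    rintro k x y hx hy ⟨h1, h2⟩
    have hηx : 0 ≤ η k * x := mul_nonneg (hη0 k) hx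
    refine ⟨fun α => ?_, fun γ v => ?_⟩
    · obtain ⟨ε, ⟨hε, γ, hγ⟩, -⟩ := hE (α + x₀)
      have hα : α = M *ᵥ γ + ε - x₀ := by rw [add_comm (M *ᵥ γ), ← hγ]; abel
      have h3 := abs_subdivision_sub_le hM (hsupp (k₀ + k)) (hB (k₀ + k)) h1 (γ := γ) (ε := ε)
        (β := x₀) (x₀ := x₀) (S := K)
        (fun z hz => mem_indexSet_of_mem_Icc hM hε hx₀ hz)
        (fun z hz => abs_sub_le_of_zeroSum_bound hC0 hpC hy (h2 γ) hz hx₀)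
      rw [← hα] at h3
      have h4 := h1 (γ - x₀)
      have h5 : |subdivisionIter M a c (k₀ + (k + 1)) α| ≤
          n * (B * (2 * C * y)) + η k * x + x := by
        have := abs_add_le (subdivisionIter M a c (k₀ + (k + 1)) α -
          subdivisionIter M a c (k₀ + k) (γ - x₀)) (subdivisionIter M a c (k₀ + k) (γ - x₀))
        rw [sub_add_cancel] at this
        exact this.trans (add_le_add h3 h4)
      have h6 := mul_le_mul_of_nonneg_right hBA hy
      have h7 := mul_le_mul_of_nonneg_right (hn1.trans hnA) hηx
      refine h5.trans ?_
      calc _ = n * (B * (2 * C)) * y + 1 * (η k * x) + x := by ring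
        _ ≤ A * y + A * (η k * x) + x := by linarith
        _ = _ := by ring
    · obtain ⟨ε, ⟨hε, γ', hγ⟩, -⟩ := hE γ
      obtain ⟨b₀, hb₀, hclose⟩ := hk₀ (k₀ + k) (Nat.le_add_right _ _)
      have hKmem : ∀ β ∈ K, ∀ z,
          ε + M *ᵥ z - β ∈ Set.Icc (0 : Fin s → ℤ) (fun _ => (N : ℤ)) → z ∈ K :=
        fun β hβ z hz => mem_indexSet_of_mem_Icc hM hε hβ hz
      obtain ⟨T, hT, hTv⟩ := exists_mem_restrictedTransitions (M := M) (K := K) (E := E) hb₀ hε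
        (fun β hβ => by
          have h3 : ∀ z, ε + M *ᵥ z - β = ε - β + M *ᵥ z := fun z => by abel
          have := sum_coset_eq_one_of_mem_limitPoints hM hsupp hsum hb₀ (ε - β) (F := K)
            fun z hz => hKmem β hβ z (by rwa [h3])
          simpa only [h3] using this)
      have h3 := abs_sum_mul_subdivision_le hM (hsupp (k₀ + k)) hC1 hp hpC hδ0.le h1 hy h2
        (γ := γ') hKmem hclose hTv (hTp T hT) v
      have hγ' : γ = M *ᵥ γ' + ε := by rw [hγ, add_comm]
      rw [← hγ'] at h3
      refine h3.trans (mul_le_mul_of_nonneg_right ?_ ((norm_nonneg v).trans (hp v)))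
      rw [hδq]
      have h4 := mul_le_mul_of_nonneg_right hnA hηx
      calc _ = (1 + q) / 2 * y + n * (η k * x) := by ring
        _ ≤ (1 + q) / 2 * y + A * (η k * x) := by linarith
        _ = _ := by ring
  obtain ⟨X₀, hX₀⟩ := isBoundedSeq_subdivisionIter hM hsupp ⟨B, hB⟩ hc k₀
  have hX₀0 : 0 ≤ X₀ := (abs_nonneg _).trans (hX₀ 0)
  have hP0 : P 0 X₀ (n * X₀) := by
    refine ⟨hX₀, fun γ v => ?_⟩
    refine (Finset.abs_sum_le_sum_abs _ _).trans
      ((Finset.sum_le_card_nsmul _ _ (p v * X₀) fun z _ => ?_).trans ?_)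
    · rw [abs_mul]
      exact mul_le_mul ((norm_le_pi_norm (v : K → ℝ) z).trans (hp v)) (hX₀ _) (abs_nonneg _)
        ((norm_nonneg v).trans (hp v))
    · rw [nsmul_eq_mul, Finset.card_univ, Fintype.card_coe]
      exact le_of_eq (by ring)
  -- The recursion with equality provides majorants for the actual bounds.
  let xy : ℕ → ℝ × ℝ := fun k => Nat.rec (X₀, n * X₀)
    (fun k z => ((1 + A * η k) * z.1 + A * z.2, (1 + q) / 2 * z.2 + A * η k * z.1)) k
  have hxy0 : ∀ k, 0 ≤ (xy k).1 ∧ 0 ≤ (xy k).2 := by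
    intro k
    induction k with
    | zero => exact ⟨hX₀0, mul_nonneg hn0 hX₀0⟩
    | succ k ih =>
      obtain ⟨h1, h2⟩ := ih
      have h3 := hη0 k
      exact ⟨by change 0 ≤ (1 + A * η k) * (xy k).1 + A * (xy k).2; positivity,
        by change 0 ≤ (1 + q) / 2 * (xy k).2 + A * η k * (xy k).1; positivity⟩
  have hPk : ∀ k, P k (xy k).1 (xy k).2 := by
    intro k
    induction k with
    | zero => exact hP0
    | succ k ih => exact hstep k _ _ (hxy0 k).1 (hxy0 k).2 ih
  obtain ⟨⟨X, hX⟩, hys⟩ := exists_bound_of_recursive_le (x := fun k => (xy k).1)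
    (y := fun k => (xy k).2) (η := η) (q := (1 + q) / 2) (A := A) (by linarith) hA0
    (fun k => (hxy0 k).1) (fun k => (hxy0 k).2) hη0 hηs (fun k => le_rfl) (fun k => le_rfl)
  refine ⟨⟨X, ?_⟩, fun k => 2 * C * (xy (k - k₀)).2, ?_, ?_⟩
  · filter_upwards [eventually_ge_atTop k₀] with k hk α
    obtain ⟨j, rfl⟩ := Nat.exists_eq_add_of_le hk
    exact ((hPk j).1 α).trans (hX j)
  · rw [← summable_nat_add_iff k₀]
    simpa using hys.mul_left (2 * C)
  · filter_upwards [eventually_ge_atTop k₀] with k hk γ x hx y hy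
    obtain ⟨j, rfl⟩ := Nat.exists_eq_add_of_le hk
    rw [Nat.add_sub_cancel_left]
    exact abs_sub_le_of_zeroSum_bound hC0 hpC (hxy0 j).2 ((hPk j).2 γ) hx hy

/-- The data stay bounded and their oscillation over translates of a finite set is summable. -/
theorem eventually_abs_le_and_summable_oscillation (hM : IsExpanding M)
    (hE : IsCosetReps M E) (hsupp : ∀ k, SupportedOnBox N (a k))
    (hbdd : ∃ B : ℝ, ∀ k α, |a k α| ≤ B) (hsum : ApproxSumRulesOne M a)
    (hρ : jointSpectralRadius
      (restrictedTransitions M (indexSet hM N E) E (limitPoints a)) < 1)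
    {c : (Fin s → ℤ) → ℝ} (hc : IsBoundedSeq c) :
    (∃ X, ∀ᶠ k in atTop, ∀ α, |subdivisionIter M a c k α| ≤ X) ∧
      ∀ F : Set (Fin s → ℤ), F.Finite → ∃ d : ℕ → ℝ, Summable d ∧ ∀ᶠ k in atTop, ∀ γ,
        ∀ x ∈ F, ∀ y ∈ F,
          |subdivisionIter M a c k (γ - x) - subdivisionIter M a c k (γ - y)| ≤ d k := by
  obtain ⟨⟨X, hX⟩, hosc⟩ :=
    eventually_abs_le_and_summable_oscillation_indexSet hM hE hsupp hbdd hsum hρ hc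
  obtain ⟨B, hB⟩ := hbdd
  refine ⟨⟨X, hX⟩, fun F hF => finite_induction_sourceSet (E := E) (N := N) hM
    (P := fun F => ∃ d : ℕ → ℝ, Summable d ∧ ∀ᶠ k in atTop, ∀ γ, ∀ x ∈ F, ∀ y ∈ F,
      |subdivisionIter M a c k (γ - x) - subdivisionIter M a c k (γ - y)| ≤ d k)
    hosc ?_ ?_ hF⟩
  · rintro A A' hAA' ⟨d, hd, h⟩
    exact ⟨d, hd, h.mono fun k hk γ x hx y hy => hk γ x (hAA' hx) y (hAA' hy)⟩
  · rintro F hF ⟨d, hd, h⟩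
    rcases F.eq_empty_or_nonempty with rfl | hne
    · exact ⟨0, summable_zero, Eventually.of_forall fun k γ x hx => absurd hx (by simp)⟩
    obtain ⟨x₀, hx₀⟩ := nonempty_sourceSet (N := N) hE hne
    set S := (finite_sourceSet (E := E) (N := N) hM hF).toFinset with hS
    set D : ℕ → ℝ := fun k => S.card * (B * d k) + sumRuleError M (a k) * X with hD
    have hDs : Summable D :=
      ((hd.mul_left B).mul_left _).add ((summable_sumRuleError hsum).mul_right X)
    -- The data of level `k + 1` are compared with those of level `k`, hence the shift; the
    -- truncated value at `0` does not matter. The factor `2` arises because both new values are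
    -- compared with the same old value at `γ' - x₀`.
    refine ⟨fun k => 2 * D (k - 1), ?_, ?_⟩
    · rw [← summable_nat_add_iff 1]
      simpa using hDs.mul_left 2
    · rw [← map_add_atTop_eq_nat 1, eventually_map]
      filter_upwards [h, hX] with k hk hXk γ x hx y hy
      obtain ⟨ε, ⟨hε, γ', hγ⟩, -⟩ := hE γ
      have hγ' : γ = M *ᵥ γ' + ε := by rw [hγ, add_comm]
      have key : ∀ z ∈ F, |subdivisionIter M a c (k + 1) (γ - z) -
          subdivisionIter M a c k (γ' - x₀)| ≤ D k := by
        intro z hz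
        rw [hγ']
        exact abs_subdivision_sub_le hM (hsupp k) (hB k) hXk
          (fun w hw => (Set.Finite.mem_toFinset _).2 ⟨ε, hε, z, hz, hw⟩)
          fun w hw => hk γ' w ((Set.Finite.mem_toFinset _).1 hw) x₀ hx₀
      have h1 := key x hx
      have h2 := key y hy
      rw [abs_sub_comm] at h2
      rw [Nat.add_sub_cancel]
      exact (abs_sub_le _ _ _).trans (by linarith)

end Oscillation

/-! ### The limit function -/

section Limit

variable {s : ℕ} {M : Matrix (Fin s) (Fin s) ℤ} {N : ℕ} {E : Finset (Fin s → ℤ)}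
  {a : ℕ → (Fin s → ℤ) → ℝ}

/-- The componentwise integer part. -/
noncomputable def floorVec (y : Fin s → ℝ) : Fin s → ℤ := fun j => ⌊y j⌋

theorem abs_sub_toRealVec_floorVec_le (y : Fin s → ℝ) (j : Fin s) :
    |y j - toRealVec (floorVec y) j| ≤ 1 := by
  simp only [toRealVec, floorVec]
  rw [abs_of_nonneg (sub_nonneg.2 (Int.floor_le _))]
  linarith [Int.lt_floor_add_one (y j)]

theorem norm_sub_toRealVec_floorVec_le (y : Fin s → ℝ) : ‖y - toRealVec (floorVec y)‖ ≤ 1 :=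
  (pi_norm_le_iff_of_nonneg zero_le_one).2 fun j => abs_sub_toRealVec_floorVec_le y j

theorem floorVec_sub_mem_Icc {y z : Fin s → ℝ} (h : ∀ j, |y j - z j| < 1) :
    floorVec y - floorVec z ∈ Set.Icc (-1 : Fin s → ℤ) 1 := by
  have key : ∀ u v : ℝ, u - v < 1 → ⌊u⌋ ≤ ⌊v⌋ + 1 := fun u v huv => by
    rw [← Int.floor_add_one]
    exact Int.floor_le_floor (by linarith)
  refine ⟨fun j => ?_, fun j => ?_⟩
  · have := key (z j) (y j) (by linarith [(abs_lt.1 (h j)).1])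
    simp only [Pi.neg_apply, Pi.one_apply, Pi.sub_apply, floorVec]
    omega
  · have := key (y j) (z j) (abs_lt.1 (h j)).2
    simp only [Pi.one_apply, Pi.sub_apply, floorVec]
    omega

/-- The offset between the refined old cell and the new cell stays in a finite set independent of
the point and the level, so one finite set controls the increments of the step functions. -/
theorem mulVec_floorVec_sub_mem_Icc (y : Fin s → ℝ) :
    M *ᵥ floorVec y - floorVec (realMatrix M *ᵥ y) ∈
      Set.Icc (-fun i => (∑ j, |M i j|) + 1) fun i => (∑ j, |M i j|) + 1 := by
  have key : ∀ i, |(M *ᵥ floorVec y - floorVec (realMatrix M *ᵥ y)) i| ≤ (∑ j, |M i j|) + 1 := by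
    intro i
    have h1 : |(realMatrix M *ᵥ (y - toRealVec (floorVec y))) i| ≤ ∑ j, |(M i j : ℝ)| := by
      simp only [Matrix.mulVec, dotProduct]
      refine (Finset.abs_sum_le_sum_abs _ _).trans (Finset.sum_le_sum fun j _ => ?_)
      rw [abs_mul]
      exact mul_le_of_le_one_right (abs_nonneg _) (abs_sub_toRealVec_floorVec_le y j)
    have h2 := abs_sub_toRealVec_floorVec_le (realMatrix M *ᵥ y) i
    have h3 : (((M *ᵥ floorVec y - floorVec (realMatrix M *ᵥ y)) i : ℤ) : ℝ) =
        ((realMatrix M *ᵥ y) i - toRealVec (floorVec (realMatrix M *ᵥ y)) i) -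
          (realMatrix M *ᵥ (y - toRealVec (floorVec y))) i := by
      rw [Matrix.mulVec_sub, ← toRealVec_mulVec]
      simp only [toRealVec, Pi.sub_apply]
      push_cast
      ring
    have h4 : |(((M *ᵥ floorVec y - floorVec (realMatrix M *ᵥ y)) i : ℤ) : ℝ)| ≤
        (∑ j, |(M i j : ℝ)|) + 1 := by
      rw [h3]
      exact (abs_sub _ _).trans (by linarith)
    exact_mod_cast h4
  exact ⟨fun i => (abs_le.1 (key i)).1, fun i => (abs_le.1 (key i)).2⟩

theorem realMatrix_pow_succ_mulVec (k : ℕ) (x : Fin s → ℝ) :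
    realMatrix M ^ (k + 1) *ᵥ x = realMatrix M *ᵥ (realMatrix M ^ k *ᵥ x) := by
  rw [pow_succ', Matrix.mulVec_mulVec]

/-- The step functions with the subdivided data as values converge uniformly to a continuous
function, if the data stay bounded and their oscillation is summable. -/
theorem exists_continuous_tendstoUniformly_floorVec (hM : IsExpanding M)
    (hsupp : ∀ k, SupportedOnBox N (a k))
    (hbdd : ∃ B : ℝ, ∀ k α, |a k α| ≤ B) (hsum : ApproxSumRulesOne M a)
    {c : (Fin s → ℤ) → ℝ} (hX : ∃ X, ∀ᶠ k in atTop, ∀ α, |subdivisionIter M a c k α| ≤ X)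
    (hosc : ∀ F : Set (Fin s → ℤ), F.Finite → ∃ d : ℕ → ℝ, Summable d ∧ ∀ᶠ k in atTop, ∀ γ,
        ∀ x ∈ F, ∀ y ∈ F,
          |subdivisionIter M a c k (γ - x) - subdivisionIter M a c k (γ - y)| ≤ d k) :
    ∃ g : (Fin s → ℝ) → ℝ, Continuous g ∧
      TendstoUniformly (fun (k : ℕ) (x : Fin s → ℝ) =>
        subdivisionIter M a c k (floorVec (realMatrix M ^ k *ᵥ x))) g atTop := by
  obtain ⟨X, hX⟩ := hX
  obtain ⟨B, hB⟩ := hbdd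
  set h : ℕ → (Fin s → ℝ) → ℝ := fun k x =>
    subdivisionIter M a c k (floorVec (realMatrix M ^ k *ᵥ x)) with hh
  set R : Fin s → ℤ := fun i => (∑ j, |M i j|) + 1 with hR
  -- The new position is `M ⌊y⌋ + 0 - β` with a bounded `β`, so the single digit `0` replaces the
  -- coset representatives. The point `0` is inserted to have the old value at `⌊y⌋` for comparison.
  have hSfin : (insert 0 (sourceSet M {0} N (Set.Icc (-R) R))).Finite :=
    (finite_sourceSet hM (Set.finite_Icc _ _)).insert 0
  obtain ⟨d, hd, hdk⟩ := hosc _ hSfin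
  set S := hSfin.toFinset with hS
  have hu : Summable fun k => S.card * (B * d k) + sumRuleError M (a k) * X :=
    ((hd.mul_left B).mul_left _).add ((summable_sumRuleError hsum).mul_right X)
  have hdiff : ∀ᶠ k in atTop, ∀ x, ‖h (k + 1) x - h k x‖ ≤
      S.card * (B * d k) + sumRuleError M (a k) * X := by
    filter_upwards [hdk, hX] with k hk hXk x
    set y := realMatrix M ^ k *ᵥ x with hy
    have hmem := mulVec_floorVec_sub_mem_Icc (M := M) y
    have h1 := abs_subdivision_sub_le hM (hsupp k) (hB k) hXk (γ := floorVec y) (ε := 0)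
      (β := M *ᵥ floorVec y - floorVec (realMatrix M *ᵥ y)) (x₀ := 0) (S := S)
      (fun z hz => (Set.Finite.mem_toFinset _).2
        (Set.mem_insert_of_mem _ ⟨0, Finset.mem_singleton_self 0, _, hmem, hz⟩))
      (fun z hz => hk _ z ((Set.Finite.mem_toFinset _).1 hz) 0 (Set.mem_insert _ _))
    rw [add_zero, sub_sub_cancel, sub_zero] at h1
    simp only [hh, realMatrix_pow_succ_mulVec]
    exact h1
  have hlim := tendstoUniformlyOn_univ.1 (tendstoUniformlyOn_tsum_nat_eventually hu
    (hdiff.mono fun k hk x _ => hk x))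
  set G : (Fin s → ℝ) → ℝ := fun x => h 0 x + ∑' n, (h (n + 1) x - h n x) with hG
  have hunif : TendstoUniformly h G atTop := by
    rw [Metric.tendstoUniformly_iff] at hlim ⊢
    intro ε hε
    filter_upwards [hlim ε hε] with n hn x
    have h1 := hn x
    rw [Finset.sum_range_sub (fun n => h n x)] at h1
    rw [Real.dist_eq] at h1 ⊢
    rw [hG]
    convert h1 using 2
    ring
  refine ⟨G, ?_, hunif⟩
  -- Continuity of the limit despite the jumps: if `M^k z` and `M^k x` differ by less than `1` in
  -- each coordinate, their integer parts differ by an element of `{-1, 0, 1}^s`, and the jump is at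
  -- most `e k → 0`.
  obtain ⟨e, he, hek⟩ := hosc (Set.Icc (-1) 1) (Set.finite_Icc _ _)
  rw [continuous_iff_continuousAt]
  intro x
  rw [Metric.continuousAt_iff']
  intro ε hε
  have h3 : 0 < ε / 3 := by linarith
  obtain ⟨k, hk, hke, hkε⟩ := ((Metric.tendstoUniformly_iff.1 hunif _ h3).and
    (hek.and (he.tendsto_atTop_zero.eventually_lt_const h3))).exists
  have hcont : Continuous fun z : Fin s → ℝ => realMatrix M ^ k *ᵥ z :=
    Continuous.matrix_mulVec continuous_const continuous_id
  have hnear := Metric.continuousAt_iff'.1 (hcont.continuousAt (x := x)) 1 one_pos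
  filter_upwards [hnear] with z hz
  have hz' : ∀ j, |(realMatrix M ^ k *ᵥ z) j - (realMatrix M ^ k *ᵥ x) j| < 1 := fun j =>
    (dist_le_pi_dist _ _ j).trans_lt hz
  have h0 : (0 : Fin s → ℤ) ∈ Set.Icc (-1 : Fin s → ℤ) 1 :=
    ⟨fun j => by simp, fun j => by simp⟩
  have h4 := hke (floorVec (realMatrix M ^ k *ᵥ z)) 0 h0 _ (floorVec_sub_mem_Icc hz')
  rw [sub_zero, sub_sub_cancel] at h4
  have h5 := hk z
  have h6 := hk x
  rw [dist_comm, Real.dist_eq] at h5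
  rw [Real.dist_eq] at h6 ⊢
  rw [abs_lt] at h5 h6 ⊢
  rw [abs_le] at h4
  simp only [hh] at h5 h6
  constructor <;> linarith [h4.1, h4.2, h5.1, h5.2, h6.1, h6.2]

end Limit

/-! ### Partitions of unity from the Strang-Fix conditions -/

section Periodization

variable {s : ℕ} {f : (Fin s → ℝ) → ℝ}

theorem HasCompactSupport.exists_norm_le (hf : HasCompactSupport f) :
    ∃ R : ℝ, ∀ y, f y ≠ 0 → ‖y‖ ≤ R := by
  obtain ⟨R, hR⟩ := hf.isBounded.exists_norm_le
  exact ⟨R, fun y hy => hR y (subset_tsupport f hy)⟩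

theorem locallyFinite_support_translates (hf : HasCompactSupport f) :
    LocallyFinite fun α : Fin s → ℤ => Function.support fun y => f (y - toRealVec α) := by
  obtain ⟨R, hR⟩ := hf.exists_norm_le
  intro y
  refine ⟨Metric.ball y 1, Metric.ball_mem_nhds y one_pos,
    (finite_setOf_norm_toRealVec_le (R + ‖y‖ + 1)).subset ?_⟩
  rintro α ⟨z, hz, hzy⟩
  have h1 := hR _ hz
  have h2 : ‖z - y‖ < 1 := mem_ball_iff_norm.1 hzy
  have h3 : toRealVec α = (z - y) + y - (z - toRealVec α) := by abel
  rw [Set.mem_ofPred_eq, h3]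
  exact (norm_sub_le _ _).trans (by linarith [norm_add_le (z - y) y])

theorem continuous_periodization (hfc : Continuous f) (hf : HasCompactSupport f) :
    Continuous fun y => ∑ᶠ α : Fin s → ℤ, f (y - toRealVec α) :=
  continuous_finsum (fun _ => hfc.comp (continuous_id.sub continuous_const))
    (locallyFinite_support_translates hf)

theorem periodization_add_toRealVec (y : Fin s → ℝ) (β : Fin s → ℤ) :
    ∑ᶠ α : Fin s → ℤ, f (y + toRealVec β - toRealVec α) =
      ∑ᶠ α : Fin s → ℤ, f (y - toRealVec α) := by
  rw [← finsum_comp_equiv (Equiv.addRight β)]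
  refine finsum_congr fun α => ?_
  rw [Equiv.coe_addRight, toRealVec_add]
  congr 1
  abel

/-- The translates of the half-open unit cube by lattice points partition the space. -/
theorem integral_eq_sum_unitCube {h : (Fin s → ℝ) → ℂ} (hint : Integrable h)
    {S : Finset (Fin s → ℤ)}
    (hS : ∀ α ∉ S, ∀ x ∈ {x : Fin s → ℝ | ∀ i, x i ∈ Set.Ioc (0 : ℝ) (0 + 1)},
      h (x - toRealVec α) = 0) :
    ∫ x, h x = ∑ α ∈ S, ∫ x in {x : Fin s → ℝ | ∀ i, x i ∈ Set.Ioc (0 : ℝ) (0 + 1)},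
      h (x - toRealVec α) := by
  set Q : Set (Fin s → ℝ) := {x | ∀ i, x i ∈ Set.Ioc (0 : ℝ) (0 + 1)} with hQ
  have hQm : MeasurableSet Q := MeasurableSet.univ_pi' fun i => measurableSet_Ioc
  have hmeas : ∀ α : Fin s → ℤ, Measurable fun x : Fin s → ℝ => x + toRealVec α :=
    fun α => measurable_add_const _
  have hmem : ∀ (α : Fin s → ℤ) (x : Fin s → ℝ),
      x ∈ (fun x : Fin s → ℝ => x + toRealVec α) ⁻¹' Q ↔ ∀ i, ⌈x i⌉ = 1 - α i := by
    intro α x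
    refine forall_congr' fun i => ?_
    simp only [Pi.add_apply, toRealVec, Int.ceil_eq_iff, Set.mem_Ioc]
    push_cast
    constructor <;> rintro ⟨h1, h2⟩ <;> constructor <;> linarith
  have hcover : ⋃ α : Fin s → ℤ, (fun x : Fin s → ℝ => x + toRealVec α) ⁻¹' Q = Set.univ := by
    refine Set.eq_univ_of_forall fun x => Set.mem_iUnion.2 ⟨fun i => 1 - ⌈x i⌉, ?_⟩
    rw [hmem]
    intro i
    ring
  have hdisj : Pairwise (Function.onFun Disjoint
      fun α : Fin s → ℤ => (fun x : Fin s → ℝ => x + toRealVec α) ⁻¹' Q) := by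
    intro α β hαβ
    refine Set.disjoint_left.2 fun x hx hx' => hαβ (funext fun i => ?_)
    have h1 := (hmem α x).1 hx i
    have h2 := (hmem β x).1 hx' i
    omega
  have h1 := integral_iUnion (μ := volume) (f := h) (fun α : Fin s → ℤ => hmeas α hQm) hdisj
    hint.integrableOn
  rw [hcover, setIntegral_univ] at h1
  have h2 : ∀ α : Fin s → ℤ, ∫ x in (fun x : Fin s → ℝ => x + toRealVec α) ⁻¹' Q, h x =
      ∫ x in Q, h (x - toRealVec α) := by
    intro α
    have := (measurePreserving_add_right (volume : Measure (Fin s → ℝ))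
      (toRealVec α)).setIntegral_preimage_emb (measurableEmbedding_addRight _)
      (fun x => h (x - toRealVec α)) Q
    simpa using this
  simp_rw [h2] at h1
  rw [h1]
  exact tsum_eq_sum fun α hα => setIntegral_eq_zero_of_forall_eq_zero fun x hx => hS α hα x hx

theorem mFourier_neg_coe (n : Fin s → ℤ) (x : Fin s → ℝ) :
    UnitAddTorus.mFourier (-n) (fun i => (x i : UnitAddCircle)) =
      Complex.exp (((-2 * Real.pi * ∑ i, x i * n i : ℝ) : ℂ) * Complex.I) := by
  simp only [UnitAddTorus.mFourier, ContinuousMap.coe_mk, fourier_coe_apply]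
  rw [← Complex.exp_sum]
  congr 1
  push_cast
  rw [Finset.mul_sum, Finset.sum_mul]
  refine Finset.sum_congr rfl fun i _ => ?_
  simp
  ring

theorem mFourier_neg_sub_toRealVec (n α : Fin s → ℤ) (x : Fin s → ℝ) :
    UnitAddTorus.mFourier (-n) (fun i => ((x - toRealVec α) i : UnitAddCircle)) =
      UnitAddTorus.mFourier (-n) (fun i => (x i : UnitAddCircle)) := by
  congr 1
  funext i
  have : ((α i : ℝ) : UnitAddCircle) = 0 := by
    rw [AddCircle.coe_eq_zero_iff]
    exact ⟨α i, by simp⟩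
  rw [Pi.sub_apply, AddCircle.coe_sub, toRealVec, this, sub_zero]

/-- Passes from Euclidean space to the product space carrying the torus characters, so that both
kinds of Fourier coefficients can be compared. -/
theorem fourierAt_eq_integral (n : Fin s → ℤ) :
    fourierAt f n = ∫ x : Fin s → ℝ,
      UnitAddTorus.mFourier (-n) (fun i => (x i : UnitAddCircle)) * (f x : ℂ) := by
  rw [fourierAt, Real.fourier_eq']
  have h := (PiLp.volume_preserving_ofLp (Fin s)).integral_comp
    (MeasurableEquiv.toLp 2 (Fin s → ℝ)).symm.measurableEmbedding
    (fun x : Fin s → ℝ => UnitAddTorus.mFourier (-n) (fun i => (x i : UnitAddCircle)) * (f x : ℂ))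
  rw [← h]
  refine integral_congr_ae (Eventually.of_forall fun x => ?_)
  simp only [mFourier_neg_coe, smul_eq_mul]
  congr 4
  simp [PiLp.inner_apply, toRealVec, mul_comm]

/-- The translates of a continuous function with compact support which satisfies the Strang-Fix
conditions form a partition of unity. -/
theorem finsum_translates_eq_one (hfc : Continuous f) (hf : HasCompactSupport f)
    (hsf : StrangFixOne f) (y : Fin s → ℝ) : ∑ᶠ α : Fin s → ℤ, f (y - toRealVec α) = 1 := by
  set Φ : (Fin s → ℝ) → ℝ := fun y => ∑ᶠ α : Fin s → ℤ, f (y - toRealVec α) with hΦ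
  let π : (Fin s → ℝ) → UnitAddTorus (Fin s) := fun x i => (x i : UnitAddCircle)
  have hπ : IsOpenQuotientMap π := IsOpenQuotientMap.piMap (f := fun _ : Fin s =>
    ((↑) : ℝ → UnitAddCircle)) fun _ => QuotientAddGroup.isOpenQuotientMap_mk
  have hfact : ∀ x y, π x = π y → Φ x = Φ y := by
    intro x y hxy
    have h1 : ∀ i, ∃ n : ℤ, x i = y i + n := by
      intro i
      have h2 : ((x i - y i : ℝ) : UnitAddCircle) = 0 := by
        rw [AddCircle.coe_sub, sub_eq_zero]
        exact congrFun hxy i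
      obtain ⟨n, hn⟩ := (AddCircle.coe_eq_zero_iff 1).1 h2
      refine ⟨n, ?_⟩
      simp only [zsmul_eq_mul, mul_one] at hn
      linarith
    choose n hn using h1
    have h2 : x = y + toRealVec n := funext hn
    rw [h2]
    exact periodization_add_toRealVec y n
  -- The periodization descends to the torus; any section of the projection defines the same
  -- function.
  let F : UnitAddTorus (Fin s) → ℂ := fun t => (Φ (Function.surjInv hπ.surjective t) : ℂ)
  have hF : ∀ x, F (π x) = (Φ x : ℂ) := fun x => by
    simp only [F]
    rw [hfact _ x (Function.surjInv_eq hπ.surjective (π x))]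
  have hFc : Continuous F := by
    rw [hπ.isQuotientMap.continuous_iff]
    have : F ∘ π = fun x => (Φ x : ℂ) := funext hF
    rw [this]
    exact Complex.continuous_ofReal.comp (continuous_periodization hfc hf)
  obtain ⟨R, hR⟩ := hf.exists_norm_le
  set S := (finite_setOf_norm_toRealVec_le (s := s) (R + 1)).toFinset with hS
  set Q : Set (Fin s → ℝ) := {x | ∀ i, x i ∈ Set.Ioc (0 : ℝ) (0 + 1)} with hQ
  have hQm : MeasurableSet Q := MeasurableSet.univ_pi' fun i => measurableSet_Ioc
  have hSQ : ∀ x ∈ Q, ∀ α, f (x - toRealVec α) ≠ 0 → α ∈ S := by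
    intro x hx α hα
    have h1 : ‖x‖ ≤ 1 := (pi_norm_le_iff_of_nonneg zero_le_one).2 fun i => by
      have := hx i
      rw [Real.norm_eq_abs, abs_of_pos this.1]
      linarith [this.2]
    have h2 : toRealVec α = x - (x - toRealVec α) := by abel
    rw [hS, Set.Finite.mem_toFinset, Set.mem_ofPred_eq, h2]
    exact (norm_sub_le _ _).trans (by linarith [hR _ hα])
  -- Unfolding: integrating the periodization against a character over the unit cube is integrating
  -- `f` against it over the whole space.
  have hcoeff : ∀ n : Fin s → ℤ, UnitAddTorus.mFourierCoeff F n = fourierAt f n := by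
    intro n
    set e : (Fin s → ℝ) → ℂ := fun x => UnitAddTorus.mFourier (-n) (π x) with he
    have hec : Continuous e := (UnitAddTorus.mFourier (-n)).continuous.comp hπ.continuous
    have hcont : Continuous fun x => e x * (f x : ℂ) :=
      hec.mul (Complex.continuous_ofReal.comp hfc)
    have hcs : HasCompactSupport fun x => e x * (f x : ℂ) :=
      (hf.comp_left (g := fun r : ℝ => (r : ℂ)) Complex.ofReal_zero).mul_left
    have hint : Integrable fun x => e x * (f x : ℂ) := hcont.integrable_of_hasCompactSupport hcs
    have hper : ∀ α x, e (x - toRealVec α) = e x := fun α x => mFourier_neg_sub_toRealVec n α x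
    rw [fourierAt_eq_integral, UnitAddTorus.mFourierCoeff_eq_integral F n 0]
    rw [integral_eq_sum_unitCube hint (S := S) fun α hα x hx => by
      have : f (x - toRealVec α) = 0 := by_contra fun h => hα (hSQ x hx α h)
      simp [this]]
    rw [← integral_finsetSum]
    · refine setIntegral_congr_fun hQm fun x hx => ?_
      simp only [hper]
      rw [← Finset.mul_sum, smul_eq_mul]
      congr 1
      refine (hF x).trans ?_
      rw [← Complex.ofReal_sum]
      congr 1
      exact finsum_eq_sum_of_support_subset _ fun α hα => hSQ x hx α hα
    · intro α _
      exact (hint.comp_sub_right (toRealVec α)).integrableOn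
  -- By the Strang-Fix conditions only the coefficient at `0` survives, so the continuous function
  -- `F` is the pointwise sum of its Fourier series, which is the constant `1`.
  have hsum : Summable (UnitAddTorus.mFourierCoeff F) := by
    refine summable_of_ne_finset_zero (s := {0}) fun n hn => ?_
    rw [hcoeff]
    exact hsf.2 n (by simpa using hn)
  have h1 := UnitAddTorus.hasSum_mFourier_series_apply_of_summable (f := ⟨F, hFc⟩) hsum (π y)
  have h2 := hasSum_single (f := fun n => UnitAddTorus.mFourierCoeff F n •
    UnitAddTorus.mFourier n (π y)) 0 fun n hn => by rw [hcoeff, hsf.2 n hn, zero_smul]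
  have h3 := h1.unique h2
  rw [hcoeff, hsf.1, UnitAddTorus.mFourier_zero] at h3
  have h4 : (Φ y : ℂ) = 1 := by
    rw [← hF y]
    simpa using h3
  exact_mod_cast h4

end Periodization

/-! ### From step functions to test functions. -/

section Convergence

variable {s : ℕ} {f : (Fin s → ℝ) → ℝ}

/-- A sum of the translates of a partition of unity is close to its coefficient at the integer
part, up to the local oscillation of the coefficients. -/
theorem exists_abs_finsum_sub_le (hfc : Continuous f) (hf : HasCompactSupport f)
    (hone : ∀ y, ∑ᶠ α : Fin s → ℤ, f (y - toRealVec α) = 1) :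
    ∃ (F : Set (Fin s → ℤ)) (C : ℝ), F.Finite ∧ 0 ∈ F ∧ ∀ (c : (Fin s → ℤ) → ℝ) (y : Fin s → ℝ)
      (D : ℝ), (∀ x ∈ F, |c (floorVec y - x) - c (floorVec y)| ≤ D) →
        |∑ᶠ α : Fin s → ℤ, c α * f (y - toRealVec α) - c (floorVec y)| ≤ C * D := by
  obtain ⟨R, hR⟩ := hf.exists_norm_le
  obtain ⟨B, hB⟩ := hf.exists_bound_of_continuous hfc
  have hfin : (insert 0 {x : Fin s → ℤ | ‖toRealVec x‖ ≤ R + 1}).Finite :=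
    (finite_setOf_norm_toRealVec_le (R + 1)).insert 0
  set S := hfin.toFinset with hS
  refine ⟨_, S.card * B, hfin, Set.mem_insert _ _, fun c y D hD => ?_⟩
  have hsum : ∀ c : (Fin s → ℤ) → ℝ, ∑ᶠ α : Fin s → ℤ, c α * f (y - toRealVec α) =
      ∑ x ∈ S, c (floorVec y - x) * f (y - toRealVec (floorVec y - x)) := by
    intro c
    rw [← finsum_comp_equiv (Equiv.subLeft (floorVec y))]
    refine finsum_eq_sum_of_support_subset _ fun x hx => ?_
    rw [hS, Set.Finite.coe_toFinset]
    right
    have hne : f (y - toRealVec (floorVec y - x)) ≠ 0 := right_ne_zero_of_mul hx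
    have h1 : toRealVec x = (y - toRealVec (floorVec y - x)) - (y - toRealVec (floorVec y)) := by
      rw [toRealVec_sub]
      abel
    rw [Set.mem_ofPred_eq, h1]
    exact (norm_sub_le _ _).trans (add_le_add (hR _ hne) (norm_sub_toRealVec_floorVec_le y))
  have h1 : ∑ x ∈ S, f (y - toRealVec (floorVec y - x)) = 1 := by
    have := hsum fun _ => 1
    simp only [one_mul] at this
    rw [← this, hone]
  -- As the weights sum to `1`, the value at the integer part can be subtracted inside the sum.
  have h2 : ∑ᶠ α : Fin s → ℤ, c α * f (y - toRealVec α) - c (floorVec y) =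
      ∑ x ∈ S, (c (floorVec y - x) - c (floorVec y)) * f (y - toRealVec (floorVec y - x)) := by
    simp_rw [sub_mul, Finset.sum_sub_distrib, ← Finset.mul_sum]
    rw [h1, mul_one, hsum]
  rw [h2, mul_assoc, ← nsmul_eq_mul]
  refine (Finset.abs_sum_le_sum_abs _ _).trans (Finset.sum_le_card_nsmul _ _ _ fun x hx => ?_)
  rw [abs_mul, mul_comm]
  exact mul_le_mul (hB _) (hD x ((Set.Finite.mem_toFinset _).1 hx)) (abs_nonneg _)
    ((norm_nonneg _).trans (hB 0))

end Convergence

/-- The limit `g` comes from the step functions, so it is chosen before the test function. The sum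
for a test function differs from the step function by at most `C * d k → 0`, uniformly in `x`. -/
theorem theorem4 {s : ℕ} (M : Matrix (Fin s) (Fin s) ℤ) (hM : IsExpanding M)
    (E : Finset (Fin s → ℤ)) (hE : IsCosetReps M E)
    (N : ℕ) (a : ℕ → (Fin s → ℤ) → ℝ)
    (hsupp : ∀ k, SupportedOnBox N (a k))
    (hbdd : ∃ B : ℝ, ∀ k α, |a k α| ≤ B)
    (hsum : ApproxSumRulesOne M a)
    (hρ : jointSpectralRadius
      (restrictedTransitions M (indexSet hM N E) E (limitPoints a)) < 1) :
    IsC0Convergent M a := by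
  intro c hc
  obtain ⟨hX, hosc⟩ := eventually_abs_le_and_summable_oscillation hM hE hsupp hbdd hsum hρ hc
  obtain ⟨g, hg, hlim⟩ :=
    exists_continuous_tendstoUniformly_floorVec hM hsupp hbdd hsum hX hosc
  refine ⟨g, hg, fun f hf => ?_⟩
  obtain ⟨F, C, hF, h0, hC⟩ := exists_abs_finsum_sub_le hf.continuous hf.hasCompactSupport
    (finsum_translates_eq_one hf.continuous hf.hasCompactSupport hf.strangFix)
  obtain ⟨d, hd, hdk⟩ := hosc F hF
  have hd0 : Tendsto (fun k => C * d k) atTop (𝓝 0) := by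
    simpa using hd.tendsto_atTop_zero.const_mul C
  rw [Metric.tendstoUniformly_iff] at hlim ⊢
  intro ε hε
  filter_upwards [hlim (ε / 2) (half_pos hε), hdk, hd0.eventually_lt_const (half_pos hε)]
    with k h1 h2 h3 x
  have h4 := hC (subdivisionIter M a c k) (realMatrix M ^ k *ᵥ x) (d k) fun z hz => by
    simpa using h2 (floorVec (realMatrix M ^ k *ᵥ x)) z hz 0 h0
  refine (dist_triangle _ _ _).trans_lt ((add_lt_add_of_lt_of_le (h1 x) ?_).trans_eq
    (add_halves ε))
  rw [dist_comm, Real.dist_eq]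
  exact h4.trans h3.le
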